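/- Let $n\ge 1$, let $\Omega\subset\mathbb R^n$ be open, and write $|A|$ for the Lebesgue measure of $A$. A function $\varphi:\Omega\times[0,\infty)\to[0,\infty]$ is a weak generalized $\Phi$-function, $\varphi\in\Phi_{\rm w}(\Omega)$, if: $x\mapsto\varphi(x,|f(x)|)$ is measurable for every measurable $f:\Omega\to\mathbb R$; for every $x\in\Omega$ the function $\varphi(x,\cdot)$ is non-decreasing with $\varphi(x,0)=\lim_{t\to0^+}\varphi(x,t)=0$ and $\lim_{t\to\infty}\varphi(x,t)=\infty$; and there is $L\ge1$ with $\varphi(x,s)/s\le L\,\varphi(x,t)/t$ for all $0<s<t$ and $x\in\Omega$. We write $\varphi\in\Phi_{\rm w}$ if $\varphi$ does not depend on $x$. Let $\varphi^{-1}(x,t):=\inf\{\tau\ge0:\varphi(x,\tau)\ge t\}$. Consider the following conditions. - (A0): there is $\beta\in(0,1]$ with $\beta\le\varphi^{-1}(x,1)\le1/\beta$ for almost every $x\in\Omega$. - (A1): there is $\beta\in(0,1)$ such that for every ball $B$ with $|B|\le1$ and almost every $x,y\in B\cap\Omega$ we have $\beta\varphi^{-1}(x,t)\le\varphi^{-1}(y,t)$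 for all $t\in[1,1/|B|]$. - (A2): there are $\varphi_\infty\in\Phi_{\rm w}$, a nonnegative $h\in L^1(\Omega)\cap L^\infty(\Omega)$, $\beta\in(0,1]$ and $s>0$ such that, for almost every $x\in\Omega$ and all $t\ge0$, $\varphi(x,\beta t)\le\varphi_\infty(t)+h(x)$ whenever $\varphi_\infty(t)\le s$, and $\varphi_\infty(\beta t)\le\varphi(x,t)+h(x)$ whenever $\varphi(x,t)\le s$. - (aInc)$_p$ on $A\times T$, where $A\subset\Omega$ and $T\subset(0,\infty)$: there is $a\ge1$ such that $\varphi(x,t)/t^p\le a\,\varphi(x,s)/s^p$ for all $t<s$ in $T$ and almost every $x\in A$. Let $L^\varphi(\Omega)$ be the space of measurable $f:\Omega\to\mathbb R$ with $\int_\Omega\varphi(x,\lambda|f(x)|)\,dx<\infty$ for some $\lambda>0$, with the quasinorm $\|f\|_\varphi:=\inf\{\lambda>0:\int_\Omega\varphi(x,|f(x)|/\lambda)\,dx\le1\}$, and let $Mf(x):=\sup_{B\ni x}\frac1{|B|}\int_{B\cap\Omega}|f(y)|\,dy$ for $x\in\Omega$, where the supremum is taken over all open balls $B\subset\mathbb R^n$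 that contain $x$. **Theorem.** Let $\varphi\in\Phi_{\rm w}(\Omega)$ satisfy (A0), (A1) and (A2). Assume that there are $t_0>0$ and $q>1$ such that $\varphi$ satisfies (aInc)$_q$ on $\Omega\times[t_0,\infty)$, and that there are a set $G\subset\Omega$ with $|G|<\infty$ and $p>1$ such that $\varphi$ satisfies (aInc)$_p$ on $(\Omega\setminus G)\times(0,\infty)$. Then $M:L^\varphi(\Omega)\to L^\varphi(\Omega)$ is bounded: there is a constant $C$ such that for every $f\in L^\varphi(\Omega)$ the function $Mf$ is finite almost everywhere in $\Omega$, belongs to $L^\varphi(\Omega)$, and satisfies $\|Mf\|_\varphi\le C\|f\|_\varphi$. -/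

import Mathlib

open MeasureTheory Set Filter Topology
open scoped NNReal ENNReal

namespace GenOrlicz

/-- Weak generalized Phi-functions on `Ω`. The function is `φ : Ω × [0,∞) → [0,∞]`; its values at
points outside `Ω` are irrelevant. Measurability is in the sense of Lebesgue, which on `Ω` is
`AEMeasurable` with respect to the restricted volume. -/
structure IsWeakPhi {n : ℕ} (Ω : Set (EuclideanSpace ℝ (Fin n)))
    (φ : EuclideanSpace ℝ (Fin n) → ℝ≥0 → ℝ≥0∞) : Prop where
  measurable_comp : ∀ f : EuclideanSpace ℝ (Fin n) → ℝ, AEMeasurable f (volume.restrict Ω) →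
    AEMeasurable (fun x => φ x ‖f x‖₊) (volume.restrict Ω)
  mono : ∀ x ∈ Ω, Monotone (φ x)
  map_zero : ∀ x ∈ Ω, φ x 0 = 0
  tendsto_zero : ∀ x ∈ Ω, Tendsto (φ x) (𝓝[>] 0) (𝓝 0)
  tendsto_top : ∀ x ∈ Ω, Tendsto (φ x) atTop (𝓝 ∞)
  almost_increasing : ∃ L : ℝ≥0, 1 ≤ L ∧ ∀ x ∈ Ω, ∀ s t : ℝ≥0, 0 < s → s < t →
    φ x s / s ≤ L * (φ x t / t)

/-- The generalized inverse `φ⁻¹(x,t) = inf {τ ≥ 0 : φ(x,τ) ≥ t}`, with `inf ∅ = ∞`. -/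
noncomputable def genInv {n : ℕ} (φ : EuclideanSpace ℝ (Fin n) → ℝ≥0 → ℝ≥0∞)
    (x : EuclideanSpace ℝ (Fin n)) (t : ℝ≥0∞) : ℝ≥0∞ :=
  ⨅ (τ : ℝ≥0) (_ : t ≤ φ x τ), (τ : ℝ≥0∞)

/-- Condition (A0) on `Ω`. -/
def A0 {n : ℕ} (Ω : Set (EuclideanSpace ℝ (Fin n)))
    (φ : EuclideanSpace ℝ (Fin n) → ℝ≥0 → ℝ≥0∞) : Prop :=
  ∃ β : ℝ≥0, 0 < β ∧ β ≤ 1 ∧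
    ∀ᵐ x ∂(volume.restrict Ω), (β : ℝ≥0∞) ≤ genInv φ x 1 ∧ genInv φ x 1 ≤ (β : ℝ≥0∞)⁻¹

/-- Condition (A1) on `Ω`. -/
def A1 {n : ℕ} (Ω : Set (EuclideanSpace ℝ (Fin n)))
    (φ : EuclideanSpace ℝ (Fin n) → ℝ≥0 → ℝ≥0∞) : Prop :=
  ∃ β : ℝ≥0, 0 < β ∧ β < 1 ∧
    ∀ (z : EuclideanSpace ℝ (Fin n)) (r : ℝ), 0 < r → volume (Metric.ball z r) ≤ 1 →
      ∀ᵐ x ∂(volume.restrict (Metric.ball z r ∩ Ω)),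
      ∀ᵐ y ∂(volume.restrict (Metric.ball z r ∩ Ω)),
        ∀ t : ℝ≥0∞, 1 ≤ t → t ≤ (volume (Metric.ball z r))⁻¹ →
          β * genInv φ x t ≤ genInv φ y t

/-- Condition (A2) on `Ω`. -/
def A2 {n : ℕ} (Ω : Set (EuclideanSpace ℝ (Fin n)))
    (φ : EuclideanSpace ℝ (Fin n) → ℝ≥0 → ℝ≥0∞) : Prop :=
  ∃ (φ_inf : ℝ≥0 → ℝ≥0∞) (h : EuclideanSpace ℝ (Fin n) → ℝ) (β s : ℝ≥0),
    IsWeakPhi (univ : Set (EuclideanSpace ℝ (Fin n))) (fun _ => φ_inf) ∧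
    (∀ x, 0 ≤ h x) ∧ MemLp h 1 (volume.restrict Ω) ∧ MemLp h ∞ (volume.restrict Ω) ∧
    0 < β ∧ β ≤ 1 ∧ 0 < s ∧
    ∀ᵐ x ∂(volume.restrict Ω), ∀ t : ℝ≥0,
      (φ_inf t ≤ s → φ x (β * t) ≤ φ_inf t + ENNReal.ofReal (h x)) ∧
      (φ x t ≤ s → φ_inf (β * t) ≤ φ x t + ENNReal.ofReal (h x))

/-- `(aInc)_p` on `A × T`: `φ(x,t) / t^p` is almost increasing in `t ∈ T`, uniformly for almost
every `x ∈ A`. -/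
def AIncOn {n : ℕ} (φ : EuclideanSpace ℝ (Fin n) → ℝ≥0 → ℝ≥0∞) (p : ℝ)
    (A : Set (EuclideanSpace ℝ (Fin n))) (T : Set ℝ≥0) : Prop :=
  ∃ a : ℝ≥0, 1 ≤ a ∧ ∀ᵐ x ∂(volume : Measure (EuclideanSpace ℝ (Fin n))), x ∈ A →
    ∀ t ∈ T, ∀ s ∈ T, t < s →
      φ x t / (t : ℝ≥0∞) ^ p ≤ a * (φ x s / (s : ℝ≥0∞) ^ p)

/-- (aInc) for large `t`: for some `t₀ > 0` and `p > 1`, `(aInc)_p` holds on `Ω × [t₀,∞)`. -/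
def AIncInfty {n : ℕ} (Ω : Set (EuclideanSpace ℝ (Fin n)))
    (φ : EuclideanSpace ℝ (Fin n) → ℝ≥0 → ℝ≥0∞) : Prop :=
  ∃ t₀ : ℝ≥0, 0 < t₀ ∧ ∃ p : ℝ, 1 < p ∧ AIncOn φ p Ω (Ici t₀)

/-- The modular `∫_Ω φ(x, |f(x)|) dx`. -/
noncomputable def modular {n : ℕ} (Ω : Set (EuclideanSpace ℝ (Fin n)))
    (φ : EuclideanSpace ℝ (Fin n) → ℝ≥0 → ℝ≥0∞) (f : EuclideanSpace ℝ (Fin n) → ℝ) : ℝ≥0∞ :=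
  ∫⁻ x in Ω, φ x ‖f x‖₊

/-- Membership of a real function on `Ω` in the generalized Orlicz space `L^φ(Ω)`. -/
def MemOrlicz {n : ℕ} (Ω : Set (EuclideanSpace ℝ (Fin n)))
    (φ : EuclideanSpace ℝ (Fin n) → ℝ≥0 → ℝ≥0∞) (f : EuclideanSpace ℝ (Fin n) → ℝ) : Prop :=
  AEMeasurable f (volume.restrict Ω) ∧
    ∃ c : ℝ≥0, 0 < c ∧ modular Ω φ (fun x => c * f x) < ∞

/-- The Luxemburg quasinorm of `L^φ(Ω)`. -/
noncomputable def orliczNorm {n : ℕ} (Ω : Set (EuclideanSpace ℝ (Fin n)))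
    (φ : EuclideanSpace ℝ (Fin n) → ℝ≥0 → ℝ≥0∞) (f : EuclideanSpace ℝ (Fin n) → ℝ) : ℝ≥0∞ :=
  ⨅ (c : ℝ≥0) (_ : 0 < c ∧ modular Ω φ (fun x => f x / c) ≤ 1), (c : ℝ≥0∞)

/-- The non-centered Hardy-Littlewood maximal function relative to `Ω`: the supremum, over all
open balls `B` that contain `x`, of `|B|⁻¹ ∫_{B ∩ Ω} |f|`. -/
noncomputable def maximal {n : ℕ} (Ω : Set (EuclideanSpace ℝ (Fin n)))
    (f : EuclideanSpace ℝ (Fin n) → ℝ) (x : EuclideanSpace ℝ (Fin n)) : ℝ≥0∞ :=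
  ⨆ (z : EuclideanSpace ℝ (Fin n)) (r : ℝ) (_ : x ∈ Metric.ball z r),
    (volume (Metric.ball z r))⁻¹ * ∫⁻ y in Metric.ball z r ∩ Ω, ‖f y‖₊

/-- The maximal operator is bounded from `L^φ(Ω)` to itself: for every `f ∈ L^φ(Ω)` the function
`Mf` is finite almost everywhere in `Ω`, belongs to `L^φ(Ω)`, and its norm is at most a constant
times that of `f`. -/
def MaximalBounded {n : ℕ} (Ω : Set (EuclideanSpace ℝ (Fin n)))
    (φ : EuclideanSpace ℝ (Fin n) → ℝ≥0 → ℝ≥0∞) : Prop :=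
  ∃ C : ℝ≥0, ∀ f : EuclideanSpace ℝ (Fin n) → ℝ, MemOrlicz Ω φ f →
    (∀ᵐ x ∂(volume.restrict Ω), maximal Ω f x < ∞) ∧
    MemOrlicz Ω φ (fun x => (maximal Ω f x).toReal) ∧
    orliczNorm Ω φ (fun x => (maximal Ω f x).toReal) ≤ C * orliczNorm Ω φ f

end GenOrlicz

/-!
The maximal operator on a generalized Orlicz space is controlled, at almost every point, by the
maximal operator on `L^p`. Let `p > 1` be the smaller of the two exponents and let `f` have modular
at most a small constant. With the function `h` of (A2), put `g = (φ(·, |f|) + h)^{1/p}` on `Ω`. For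
almost every `x ∈ Ω` and suitable constants `ε`, `C`, the claim is
`φ(x, ε Mf(x)) ≤ C ((Mg(x))^p + h(x)) + 1_G(x)`.
Since `∫ (Mg)^p ≤ C ∫ g^p ≤ C (1 + ‖h‖₁)` and `|G| < ∞`, the right-hand side has bounded integral,
and the almost increasing condition on `φ(x, t) / t` turns a bounded modular into one that is at most
one; homogeneity then gives the bound for the quasinorm (`maximalBounded_of_modular`).

The pointwise claim is proved ball by ball (`apply_le_of_lt_lintegral`), splitting `f` at a level
`K` at which `φ(x, K) ≥ 1` and above which `(aInc)_p` holds.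

* Large values (`apply_le_of_lt_lintegral_large`). If the mean `τ` of the large part over the ball
  `B` is large, then `|B| ≤ 1`. By (A1), `φ(y, τ/2)` is at least `min {φ(x, β τ/2), 1/|B|}` up to a
  factor two, for almost every `y ∈ B`, and by `(aInc)_p` the mean of `φ(y, |f|)^{1/p}` controls the
  power `1/p` of this minimum. As the modular of `f` is small, the minimum is not `1/|B|`. If `τ` is
  bounded, then outside `G` the bound `φ(x, ε τ) ≤ C τ^p` suffices, and in `G` a constant does.
* Small values (`apply_le_of_lt_lintegral_small`). Their means are at most `K`, so that in `G` a
  constant suffices again. Outside `G`, `φ(x, ·)^{1/p}` satisfies an inequality of Jensen type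
  (`mul_le_lintegral_of_lt_lintegral`), and `φ(x, β |f(y)|) ≤ φ(y, |f(y)|) + h(y) + h(x)` by (A2).

Condition (A1) has an exceptional set for each ball, so it is used only for countably many balls,
which are large enough to compare with all others (`exists_ball_superset`). The `L^p` bound for the
maximal operator (`lintegral_ballMax_rpow_le`) is deduced from the Vitali covering lemma through the
weak type inequality and the layer cake formula.
-/

/-! ### The Hardy–Littlewood maximal theorem -/

namespace GenOrlicz

section BallMax

section Metric

variable {E : Type*} [PseudoMetricSpace E] [MeasurableSpace E] (μ : Measure E)

/-- The non-centered Hardy–Littlewood maximal function of an `ℝ≥0∞`-valued function, the supremum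
being taken over all open balls that contain the point. -/
noncomputable def ballMax (g : E → ℝ≥0∞) (x : E) : ℝ≥0∞ :=
  ⨆ (z : E) (r : ℝ) (_ : x ∈ Metric.ball z r),
    (μ (Metric.ball z r))⁻¹ * ∫⁻ y in Metric.ball z r, g y ∂μ

variable {μ}

lemma lt_ballMax_iff {g : E → ℝ≥0∞} {x : E} {t : ℝ≥0∞} :
    t < ballMax μ g x ↔ ∃ (z : E) (r : ℝ), x ∈ Metric.ball z r ∧
      t < (μ (Metric.ball z r))⁻¹ * ∫⁻ y in Metric.ball z r, g y ∂μ := by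
  simp only [ballMax, lt_iSup_iff, exists_prop]

lemma average_le_ballMax (g : E → ℝ≥0∞) {x z : E} {r : ℝ} (hx : x ∈ Metric.ball z r) :
    (μ (Metric.ball z r))⁻¹ * ∫⁻ y in Metric.ball z r, g y ∂μ ≤ ballMax μ g x :=
  le_iSup₂_of_le z r (le_iSup_of_le hx le_rfl)

lemma isOpen_lt_ballMax (g : E → ℝ≥0∞) (t : ℝ≥0∞) : IsOpen {x | t < ballMax μ g x} := by
  rw [isOpen_iff_mem_nhds]
  intro x hx
  obtain ⟨z, r, hxz, h⟩ := lt_ballMax_iff.1 hx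
  filter_upwards [Metric.isOpen_ball.mem_nhds hxz] with y hy
  exact lt_ballMax_iff.2 ⟨z, r, hy, h⟩

lemma ballMax_congr {g g' : E → ℝ≥0∞} (h : g =ᵐ[μ] g') : ballMax μ g = ballMax μ g' := by
  funext x
  simp only [ballMax]
  refine iSup_congr fun z => iSup_congr fun r => iSup_congr fun _ => ?_
  rw [lintegral_congr_ae (ae_restrict_of_ae h)]

lemma ballMax_le_add {g g₁ g₂ : E → ℝ≥0∞} (hm : Measurable g₁) (h : ∀ y, g y ≤ g₁ y + g₂ y)
    (x : E) : ballMax μ g x ≤ ballMax μ g₁ x + ballMax μ g₂ x := by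
  refine iSup₂_le fun z r => iSup_le fun hx => ?_
  calc _ ≤ (μ (Metric.ball z r))⁻¹ * ∫⁻ y in Metric.ball z r, (g₁ y + g₂ y) ∂μ := by
        gcongr; exact h _
    _ = (μ (Metric.ball z r))⁻¹ * (∫⁻ y in Metric.ball z r, g₁ y ∂μ) +
        (μ (Metric.ball z r))⁻¹ * ∫⁻ y in Metric.ball z r, g₂ y ∂μ := by
        rw [lintegral_add_left hm, mul_add]
    _ ≤ _ := add_le_add (average_le_ballMax _ hx) (average_le_ballMax _ hx)

lemma measurable_ballMax [OpensMeasurableSpace E] (g : E → ℝ≥0∞) : Measurable (ballMax μ g) :=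
  measurable_of_Ioi fun t => (isOpen_lt_ballMax g t).measurableSet

lemma measure_ball_ne_zero_of_mem [μ.IsOpenPosMeasure] {x z : E} {r : ℝ} (hx : x ∈ Metric.ball z r) :
    μ (Metric.ball z r) ≠ 0 :=
  (Metric.isOpen_ball.measure_pos μ ⟨x, hx⟩).ne'

lemma ballMax_const_le [ProperSpace E] [μ.IsOpenPosMeasure]
    [IsFiniteMeasureOnCompacts μ] (c : ℝ≥0∞) (x : E) : ballMax μ (fun _ => c) x ≤ c := by
  refine iSup₂_le fun z r => iSup_le fun hx => ?_
  rw [setLIntegral_const, mul_comm c, ← mul_assoc,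
    ENNReal.inv_mul_cancel (measure_ball_ne_zero_of_mem hx) measure_ball_lt_top.ne, one_mul]

end Metric

variable {E : Type*} [NormedAddCommGroup E] [NormedSpace ℝ E] [FiniteDimensional ℝ E]
  [MeasurableSpace E] [BorelSpace E] {μ : Measure E} [μ.IsAddHaarMeasure]

/-- The weak type `(1,1)` inequality, from the Vitali covering lemma. -/
lemma measure_lt_ballMax_le [Nontrivial E] (g : E → ℝ≥0∞) {t : ℝ≥0∞} (ht : t ≠ 0)
    (ht' : t ≠ ∞) :
    t * μ {x | t < ballMax μ g x} ≤ 5 ^ Module.finrank ℝ E * ∫⁻ y, g y ∂μ := by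
  set d := Module.finrank ℝ E
  have hd : 0 < d := Module.finrank_pos
  rcases eq_or_ne (∫⁻ y, g y ∂μ) ∞ with hI | hI
  · rw [hI, ENNReal.mul_top (by simp)]; exact le_top
  set T : Set (E × ℝ) := {b | 0 < b.2 ∧
    t * μ (Metric.ball b.1 b.2) ≤ ∫⁻ y in Metric.ball b.1 b.2, g y ∂μ} with hT
  have h1 : μ (Metric.ball (0 : E) 1) ≠ 0 := (Metric.measure_ball_pos μ _ one_pos).ne'
  have h1' : μ (Metric.ball (0 : E) 1) ≠ ∞ := measure_ball_lt_top.ne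
  set A : ℝ≥0∞ := (∫⁻ y, g y ∂μ) / (t * μ (Metric.ball (0 : E) 1)) with hA
  have hAtop : A ≠ ∞ := ENNReal.div_ne_top hI (mul_ne_zero ht h1)
  -- The integral of `g` bounds the measure, hence the radius, of the balls in `T`.
  have hR : ∀ b ∈ T, b.2 ≤ max 1 A.toReal := by
    rintro ⟨z, r⟩ ⟨hr, hb⟩
    simp only at hr hb ⊢
    rcases le_or_gt r 1 with h | h
    · exact le_max_of_le_left h
    refine le_max_of_le_right ?_
    have h2 : t * (ENNReal.ofReal (r ^ d) * μ (Metric.ball (0 : E) 1)) ≤ ∫⁻ y, g y ∂μ := by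
      rw [← Measure.addHaar_ball μ z hr.le]
      exact hb.trans (setLIntegral_le_lintegral _ _)
    have h3 : ENNReal.ofReal (r ^ d) ≤ A := by
      rw [hA, ENNReal.le_div_iff_mul_le (Or.inl (mul_ne_zero ht h1))
        (Or.inl (ENNReal.mul_ne_top ht' h1'))]
      calc _ = t * (ENNReal.ofReal (r ^ d) * μ (Metric.ball (0 : E) 1)) := by ring
        _ ≤ _ := h2
    have h4 := (ENNReal.ofReal_le_iff_le_toReal hAtop).1 h3
    exact (le_self_pow₀ h.le hd.ne').trans h4
  obtain ⟨u, huT, hdisj, hcov⟩ := Vitali.exists_disjoint_subfamily_covering_enlargement_closedBall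
    T Prod.fst Prod.snd _ hR 5 (by norm_num)
  have hdisj' : u.PairwiseDisjoint fun b => Metric.ball b.1 b.2 := fun a ha b hb hab =>
    (hdisj ha hb hab).mono Metric.ball_subset_closedBall Metric.ball_subset_closedBall
  have hucount : u.Countable := hdisj'.countable_of_isOpen (fun _ _ => Metric.isOpen_ball)
    fun b hb => ⟨b.1, Metric.mem_ball_self (huT hb).1⟩
  have hsub : {x | t < ballMax μ g x} ⊆ ⋃ b ∈ u, Metric.closedBall b.1 (5 * b.2) := by
    intro x hx
    obtain ⟨z, r, hxz, h⟩ := lt_ballMax_iff.1 hx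
    have hzr : (z, r) ∈ T := by
      refine ⟨Metric.pos_of_mem_ball hxz, ?_⟩
      have h' := h.le
      rw [mul_comm, ← div_eq_mul_inv, ENNReal.le_div_iff_mul_le
        (Or.inl (measure_ball_ne_zero_of_mem hxz)) (Or.inl measure_ball_lt_top.ne)] at h'
      exact h'
    obtain ⟨b, hb, hsub⟩ := hcov _ hzr
    exact mem_biUnion hb (hsub (Metric.ball_subset_closedBall hxz))
  have : Countable u := hucount.to_subtype
  calc t * μ {x | t < ballMax μ g x}
      ≤ t * μ (⋃ b ∈ u, Metric.closedBall b.1 (5 * b.2)) := by gcongr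
    _ ≤ t * ∑' b : u, μ (Metric.closedBall b.1.1 (5 * b.1.2)) := by
        gcongr
        exact measure_biUnion_le μ hucount _
    _ = 5 ^ d * ∑' b : u, t * μ (Metric.ball b.1.1 b.1.2) := by
        rw [← ENNReal.tsum_mul_left, ← ENNReal.tsum_mul_left]
        congr 1 with b
        have hb := (huT b.2).1
        rw [Measure.addHaar_closedBall μ _ (by positivity), Measure.addHaar_ball μ _ hb.le,
          mul_pow, ENNReal.ofReal_mul (by positivity), ENNReal.ofReal_pow (by norm_num)]
        simp only [ENNReal.ofReal_ofNat]
        ring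
    _ ≤ 5 ^ d * ∑' b : u, ∫⁻ y in Metric.ball b.1.1 b.1.2, g y ∂μ := by
        gcongr with b
        exact (huT b.2).2
    _ ≤ 5 ^ d * ∫⁻ y, g y ∂μ := by
        gcongr
        rw [← lintegral_biUnion hucount (fun _ _ => measurableSet_ball) hdisj']
        exact setLIntegral_le_lintegral _ _

/-- The weak type inequality that keeps only the large values of `g` on the right. -/
lemma measure_lt_ballMax_le_large [Nontrivial E] {g : E → ℝ≥0∞} (hg : Measurable g) {t : ℝ≥0∞}
    (ht : t ≠ 0) (ht' : t ≠ ∞) :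
    t * μ {x | t < ballMax μ g x} ≤
      2 * 5 ^ Module.finrank ℝ E * ∫⁻ y, {y | t < 2 * g y}.indicator g y ∂μ := by
  have hs : MeasurableSet {y | t < 2 * g y} := measurableSet_lt measurable_const (hg.const_mul 2)
  have hle : ∀ y, g y ≤ {y | t < 2 * g y}.indicator g y + t / 2 := by
    intro y
    by_cases hy : t < 2 * g y
    · rw [indicator_of_mem (show y ∈ {y | t < 2 * g y} from hy)]; exact le_self_add
    · rw [indicator_of_notMem (show y ∉ {y | t < 2 * g y} from hy), zero_add,
        ENNReal.le_div_iff_mul_le (by simp) (by simp), mul_comm]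
      exact not_lt.1 hy
  have hsub : {x | t < ballMax μ g x} ⊆
      {x | t / 2 < ballMax μ ({y | t < 2 * g y}.indicator g) x} := by
    intro x hx
    by_contra hcon
    simp only [mem_ofPred_eq, not_lt] at hcon hx
    refine hx.not_ge ?_
    calc ballMax μ g x ≤ _ := ballMax_le_add (hg.indicator hs) hle x
      _ ≤ t / 2 + t / 2 := add_le_add hcon (ballMax_const_le _ _)
      _ = t := ENNReal.add_halves t
  calc t * μ {x | t < ballMax μ g x}
      ≤ 2 * (t / 2 * μ {x | t / 2 < ballMax μ ({y | t < 2 * g y}.indicator g) x}) := by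
        rw [← mul_assoc, ENNReal.mul_div_cancel two_ne_zero ENNReal.ofNat_ne_top]
        gcongr
    _ ≤ 2 * (5 ^ Module.finrank ℝ E * ∫⁻ y, {y | t < 2 * g y}.indicator g y ∂μ) := by
        exact mul_le_mul_right (measure_lt_ballMax_le _
          (ENNReal.div_ne_zero.2 ⟨ht, ENNReal.ofNat_ne_top⟩)
          (ENNReal.div_ne_top ht' two_ne_zero)) _
    _ = _ := by ring

/-- The layer cake formula for a power of an extended non-negative number. -/
lemma lintegral_Ioi_indicator_lt_rpow {p : ℝ} (hp : 0 < p) (a : ℝ≥0∞) :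
    ∫⁻ t in Ioi (0 : ℝ), {t : ℝ | ENNReal.ofReal t < a}.indicator
      (fun t => ENNReal.ofReal (p * t ^ (p - 1))) t = a ^ p := by
  have hfin : ∀ b : ℝ, 0 ≤ b → ∫⁻ t in Ioi (0 : ℝ), {t : ℝ | ENNReal.ofReal t <
      ENNReal.ofReal b}.indicator (fun t => ENNReal.ofReal (p * t ^ (p - 1))) t =
      ENNReal.ofReal b ^ p := by
    intro b hb
    have hm : MeasurableSet {t : ℝ | ENNReal.ofReal t < ENNReal.ofReal b} :=
      measurableSet_lt ENNReal.measurable_ofReal measurable_const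
    have hset : {t : ℝ | ENNReal.ofReal t < ENNReal.ofReal b} ∩ Ioi 0 = Ioo 0 b := by
      ext t
      simp only [mem_inter_iff, mem_ofPred_eq, mem_Ioi, mem_Ioo]
      constructor
      · rintro ⟨h, h0⟩
        exact ⟨h0, (ENNReal.ofReal_lt_ofReal_iff_of_nonneg h0.le).1 h⟩
      · rintro ⟨h0, h⟩
        exact ⟨(ENNReal.ofReal_lt_ofReal_iff_of_nonneg h0.le).2 h, h0⟩
    rw [lintegral_indicator hm, Measure.restrict_restrict hm, hset,
      setLIntegral_congr Ioo_ae_eq_Ioc]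
    have hii : IntervalIntegrable (fun t : ℝ => p * t ^ (p - 1)) volume 0 b :=
      (intervalIntegral.intervalIntegrable_rpow' (by linarith)).const_mul p
    rw [← ofReal_integral_eq_lintegral_ofReal
      ((intervalIntegrable_iff_integrableOn_Ioc_of_le hb).1 hii), 
      ← intervalIntegral.integral_of_le hb, intervalIntegral.integral_const_mul,
      integral_rpow (Or.inl (by linarith)), ENNReal.ofReal_rpow_of_nonneg hb hp.le]
    · congr 1
      rw [sub_add_cancel, Real.zero_rpow hp.ne', sub_zero, mul_div_cancel₀ _ hp.ne']
    · filter_upwards [ae_restrict_mem measurableSet_Ioc] with t ht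
      exact mul_nonneg hp.le (Real.rpow_nonneg ht.1.le _)
  rcases eq_or_ne a ∞ with rfl | ha
  · rw [ENNReal.top_rpow_of_pos hp, eq_top_iff]
    refine ENNReal.le_of_forall_nnreal_lt fun r _ => ?_
    have h := hfin ((r : ℝ) ^ p⁻¹) (by positivity)
    rw [ENNReal.ofReal_rpow_of_nonneg (by positivity) hp.le,
      Real.rpow_inv_rpow (NNReal.coe_nonneg r) hp.ne', ENNReal.ofReal_coe_nnreal] at h
    rw [← h]
    refine lintegral_mono fun t => ?_
    refine indicator_le_indicator_of_subset ?_ (fun _ => zero_le) t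
    intro t ht
    exact ENNReal.ofReal_lt_top
  · simpa only [ENNReal.ofReal_toReal ha] using hfin a.toReal ENNReal.toReal_nonneg

/-- The maximal operator is bounded on `L^p` for `1 < p`. -/
lemma lintegral_ballMax_rpow_le [Nontrivial E] {p : ℝ} (hp : 1 < p) {g : E → ℝ≥0∞}
    (hg : AEMeasurable g μ) :
    ∫⁻ x, ballMax μ g x ^ p ∂μ ≤ 2 * 5 ^ Module.finrank ℝ E * ENNReal.ofReal (p / (p - 1)) *
      2 ^ (p - 1) * ∫⁻ x, g x ^ p ∂μ := by
  wlog hgm : Measurable g generalizing g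
  · have h := this (g := hg.mk g) hg.measurable_mk.aemeasurable hg.measurable_mk
    rw [ballMax_congr hg.ae_eq_mk]
    refine h.trans_eq ?_
    congr 1
    refine lintegral_congr_ae ?_
    filter_upwards [hg.ae_eq_mk] with x hx
    rw [hx]
  have hp1 : 0 < p - 1 := by linarith
  set N : ℝ≥0∞ := 2 * 5 ^ Module.finrank ℝ E
  have hmeas : ∀ (r : ℝ) (F : E → ℝ≥0∞), Measurable F → Measurable
      (Function.uncurry fun (x : E) (t : ℝ) => {t : ℝ | ENNReal.ofReal t < F x}.indicator
      (fun t => ENNReal.ofReal (r * t ^ (r - 1))) t) := by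
    intro r F hF
    have hset : MeasurableSet {q : E × ℝ | ENNReal.ofReal q.2 < F q.1} :=
      measurableSet_lt (ENNReal.measurable_ofReal.comp measurable_snd) (hF.comp measurable_fst)
    have : (Function.uncurry fun (x : E) (t : ℝ) => {t : ℝ | ENNReal.ofReal t < F x}.indicator
      (fun t => ENNReal.ofReal (r * t ^ (r - 1))) t) = {q : E × ℝ | ENNReal.ofReal q.2 <
        F q.1}.indicator (fun q => ENNReal.ofReal (r * q.2 ^ (r - 1))) := by
      ext ⟨x, t⟩
      simp [Function.uncurry, indicator]
    rw [this]
    refine Measurable.indicator ?_ hset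
    fun_prop
  calc ∫⁻ x, ballMax μ g x ^ p ∂μ
      = ∫⁻ x, (∫⁻ t in Ioi (0 : ℝ), {t : ℝ | ENNReal.ofReal t < ballMax μ g x}.indicator
          (fun t => ENNReal.ofReal (p * t ^ (p - 1))) t) ∂μ := by
        simp_rw [lintegral_Ioi_indicator_lt_rpow (zero_lt_one.trans hp)]
    _ = ∫⁻ t in Ioi (0 : ℝ), ∫⁻ x, {t : ℝ | ENNReal.ofReal t < ballMax μ g x}.indicator
          (fun t => ENNReal.ofReal (p * t ^ (p - 1))) t ∂μ :=
        lintegral_lintegral_swap (hmeas p _ (measurable_ballMax g)).aemeasurable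
    _ ≤ ∫⁻ t in Ioi (0 : ℝ), ∫⁻ x, N * ENNReal.ofReal (p / (p - 1)) * (g x *
          {t : ℝ | ENNReal.ofReal t < 2 * g x}.indicator
          (fun t => ENNReal.ofReal ((p - 1) * t ^ (p - 1 - 1))) t) ∂μ := by
        refine setLIntegral_mono' measurableSet_Ioi fun t (ht : 0 < t) => ?_
        have ht0 : ENNReal.ofReal t ≠ 0 := by simpa using ht
        set D : ℝ≥0∞ := ENNReal.ofReal ((p - 1) * t ^ (p - 1 - 1))
        have hD : ENNReal.ofReal (p * t ^ (p - 1)) =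
            ENNReal.ofReal (p / (p - 1)) * D * ENNReal.ofReal t := by
          rw [← ENNReal.ofReal_mul (by positivity), ← ENNReal.ofReal_mul (by positivity)]
          congr 1
          rw [Real.rpow_sub_one ht.ne' (p - 1)]
          field_simp
        calc ∫⁻ x, {t : ℝ | ENNReal.ofReal t < ballMax μ g x}.indicator
              (fun t => ENNReal.ofReal (p * t ^ (p - 1))) t ∂μ
            = ENNReal.ofReal (p * t ^ (p - 1)) * μ {x | ENNReal.ofReal t < ballMax μ g x} := by
              rw [← lintegral_indicator_const (isOpen_lt_ballMax g _).measurableSet]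
              rfl
          _ = ENNReal.ofReal (p / (p - 1)) * D *
                (ENNReal.ofReal t * μ {x | ENNReal.ofReal t < ballMax μ g x}) := by
              rw [hD]; ring
          _ ≤ ENNReal.ofReal (p / (p - 1)) * D * (N *
                ∫⁻ y, {y | ENNReal.ofReal t < 2 * g y}.indicator g y ∂μ) := by
              exact mul_le_mul_right
                (measure_lt_ballMax_le_large hgm ht0 ENNReal.ofReal_ne_top) _
          _ = N * ENNReal.ofReal (p / (p - 1)) *
                ∫⁻ y, {y | ENNReal.ofReal t < 2 * g y}.indicator g y * D ∂μ := by
              rw [lintegral_mul_const' _ _ ENNReal.ofReal_ne_top]; ring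
          _ = ∫⁻ x, N * ENNReal.ofReal (p / (p - 1)) * (g x *
                {t : ℝ | ENNReal.ofReal t < 2 * g x}.indicator
                (fun t => ENNReal.ofReal ((p - 1) * t ^ (p - 1 - 1))) t) ∂μ := by
              rw [lintegral_const_mul']
              · congr 2 with y
                by_cases hy : ENNReal.ofReal t < 2 * g y
                · simp [indicator, hy, D]
                · simp [indicator, hy]
              · exact ENNReal.mul_ne_top (ENNReal.mul_ne_top (by simp) (by simp)) (by simp)
    _ = ∫⁻ x, (∫⁻ t in Ioi (0 : ℝ), N * ENNReal.ofReal (p / (p - 1)) * (g x *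
          {t : ℝ | ENNReal.ofReal t < 2 * g x}.indicator
          (fun t => ENNReal.ofReal ((p - 1) * t ^ (p - 1 - 1))) t)) ∂μ := by
        refine (lintegral_lintegral_swap (Measurable.aemeasurable ?_)).symm
        exact ((hgm.comp measurable_fst).mul (hmeas (p - 1) _ (hgm.const_mul 2))).const_mul _
    _ = ∫⁻ x, N * ENNReal.ofReal (p / (p - 1)) * 2 ^ (p - 1) * g x ^ p ∂μ := by
        refine lintegral_congr fun x => ?_
        rw [lintegral_const_mul, lintegral_const_mul, lintegral_Ioi_indicator_lt_rpow hp1,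
          ENNReal.mul_rpow_of_nonneg _ _ hp1.le]
        · have : g x * g x ^ (p - 1) = g x ^ p := by
            conv_rhs => rw [show p = 1 + (p - 1) by ring,
              ENNReal.rpow_add_of_nonneg _ _ zero_le_one hp1.le, ENNReal.rpow_one]
          rw [← this]; ring
        · exact (hmeas (p - 1) _ (hgm.const_mul 2)).comp measurable_prodMk_left
        · exact ((hmeas (p - 1) _ (hgm.const_mul 2)).comp measurable_prodMk_left).const_mul _
    _ = _ := by
        rw [lintegral_const_mul _ (hgm.pow_const p)]

/-- Every ball lies in a ball with centre in a fixed dense sequence and rational radius, of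
comparable volume. -/
lemma exists_ball_superset [Nontrivial E] (z : E) {r : ℝ} (hr : 0 < r) :
    ∃ (i : ℕ) (q : ℚ), Metric.ball z r ⊆ Metric.ball (TopologicalSpace.denseSeq E i) q ∧
      μ (Metric.ball (TopologicalSpace.denseSeq E i) q) ≤
        2 ^ Module.finrank ℝ E * μ (Metric.ball z r) := by
  obtain ⟨i, hi⟩ := (TopologicalSpace.denseRange_denseSeq E).exists_dist_lt z
    (show 0 < r / 2 by positivity)
  obtain ⟨q, hq1, hq2⟩ := exists_rat_btwn (show r + r / 2 < 2 * r by linarith)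
  refine ⟨i, q, Metric.ball_subset_ball' (by linarith), ?_⟩
  have hq0 : (0 : ℝ) ≤ q := by linarith
  rw [Measure.addHaar_ball μ _ hq0, Measure.addHaar_ball μ _ hr.le, ← mul_assoc]
  gcongr
  rw [← ENNReal.ofReal_ofNat, ← ENNReal.ofReal_pow (by norm_num),
    ← ENNReal.ofReal_mul (by positivity), ← mul_pow]
  exact ENNReal.ofReal_le_ofReal (pow_le_pow_left₀ hq0 hq2.le _)

end BallMax

end GenOrlicz

/-! ### Consequences of the structural conditions on `φ` -/

namespace GenOrlicz

variable {n : ℕ} {Ω : Set (EuclideanSpace ℝ (Fin n))}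
  {φ : EuclideanSpace ℝ (Fin n) → ℝ≥0 → ℝ≥0∞}

lemma IsWeakPhi.exists_le_mul (hφ : IsWeakPhi Ω φ) :
    ∃ L : ℝ≥0, 1 ≤ L ∧ ∀ x ∈ Ω, ∀ l t : ℝ≥0, l ≤ 1 → φ x (l * t) ≤ L * l * φ x t := by
  obtain ⟨L, hL, h⟩ := hφ.almost_increasing
  refine ⟨L, hL, fun x hx l t hl => ?_⟩
  rcases eq_or_ne l 0 with rfl | hl0
  · simp [hφ.map_zero x hx]
  rcases eq_or_ne t 0 with rfl | ht0
  · simp [hφ.map_zero x hx]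
  rcases hl.eq_or_lt with rfl | hl1
  · simpa using le_mul_of_one_le_left zero_le (show (1 : ℝ≥0∞) ≤ L by exact_mod_cast hL)
  have hlt : l * t < t := mul_lt_of_lt_one_left (pos_iff_ne_zero.2 ht0) hl1
  have := h x hx (l * t) t (by positivity) hlt
  have ht0' : (t : ℝ≥0∞) ≠ 0 := by exact_mod_cast ht0
  rw [ENNReal.div_le_iff (by exact_mod_cast mul_ne_zero hl0 ht0) ENNReal.coe_ne_top] at this
  refine this.trans_eq ?_
  calc (L : ℝ≥0∞) * (φ x t / t) * ((l * t : ℝ≥0) : ℝ≥0∞) = L * l * (φ x t / t * t) := by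
        push_cast; ring
    _ = _ := by rw [ENNReal.div_mul_cancel ht0' ENNReal.coe_ne_top]

/-- `(aInc)_q` in multiplicative form, with the exponent lowered to any `p ≤ q`. -/
lemma AIncOn.rpow_mul_le {q : ℝ} {A : Set (EuclideanSpace ℝ (Fin n))} {T : Set ℝ≥0}
    (h : AIncOn φ q A T) {p : ℝ} (hpq : p ≤ q) :
    ∃ a : ℝ≥0, 1 ≤ a ∧ ∀ᵐ x ∂(volume : Measure (EuclideanSpace ℝ (Fin n))), x ∈ A →
      ∀ t l : ℝ≥0, 0 < t → 1 ≤ l → t ∈ T → l * t ∈ T →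
        (l : ℝ≥0∞) ^ p * φ x t ≤ a * φ x (l * t) := by
  obtain ⟨a, ha, h⟩ := h
  refine ⟨a, ha, ?_⟩
  filter_upwards [h] with x hx hxA t l ht0 hl htT hltT
  rcases hl.eq_or_lt with rfl | hl1
  · simpa using le_mul_of_one_le_left zero_le (show (1 : ℝ≥0∞) ≤ a by exact_mod_cast ha)
  have h1 := hx hxA t htT (l * t) hltT (lt_mul_of_one_lt_left ht0 hl1)
  have htop : ∀ r : ℝ≥0, 0 < r → (r : ℝ≥0∞) ^ q ≠ ∞ ∧ (r : ℝ≥0∞) ^ q ≠ 0 := fun r hr => by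
    rw [← ENNReal.coe_rpow_of_ne_zero hr.ne']
    exact ⟨ENNReal.coe_ne_top, by exact_mod_cast (NNReal.rpow_pos hr).ne'⟩
  have hl0 : 0 < l := zero_lt_one.trans hl1
  obtain ⟨ht1, ht2⟩ := htop t ht0
  obtain ⟨hl1', hl2'⟩ := htop l hl0
  calc (l : ℝ≥0∞) ^ p * φ x t ≤ (l : ℝ≥0∞) ^ q * φ x t := by
        gcongr
        exact_mod_cast hl
    _ = (l : ℝ≥0∞) ^ q * (t : ℝ≥0∞) ^ q * (φ x t / (t : ℝ≥0∞) ^ q) := by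
        rw [mul_assoc, ENNReal.mul_div_cancel ht2 ht1]
    _ ≤ (l : ℝ≥0∞) ^ q * (t : ℝ≥0∞) ^ q *
          (a * (φ x (l * t) / ((l * t : ℝ≥0) : ℝ≥0∞) ^ q)) := by gcongr
    _ = a * (((l * t : ℝ≥0) : ℝ≥0∞) ^ q * (φ x (l * t) / ((l * t : ℝ≥0) : ℝ≥0∞) ^ q)) := by
        rw [ENNReal.coe_mul, ENNReal.mul_rpow_of_ne_top ENNReal.coe_ne_top ENNReal.coe_ne_top]
        ring
    _ = a * φ x (l * t) := by
        rw [ENNReal.mul_div_cancel (htop _ (mul_pos hl0 ht0)).2 (htop _ (mul_pos hl0 ht0)).1]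

lemma genInv_le {x : EuclideanSpace ℝ (Fin n)} {t : ℝ≥0∞} {τ : ℝ≥0} (h : t ≤ φ x τ) :
    genInv φ x t ≤ τ :=
  iInf₂_le τ h

lemma le_of_genInv_lt {x : EuclideanSpace ℝ (Fin n)} (hmono : Monotone (φ x)) {t : ℝ≥0∞}
    {τ : ℝ≥0} (h : genInv φ x t < τ) : t ≤ φ x τ := by
  simp only [genInv, iInf_lt_iff] at h
  obtain ⟨σ, hσ, hlt⟩ := h
  exact hσ.trans (hmono (by exact_mod_cast hlt.le))

lemma A0.exists_bounds (hφ : IsWeakPhi Ω φ) (hΩ : MeasurableSet Ω) (h : A0 Ω φ) :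
    ∃ b : ℝ≥0, 0 < b ∧ ∀ᵐ x ∂(volume.restrict Ω), φ x b ≤ 1 ∧ 1 ≤ φ x b⁻¹ := by
  obtain ⟨β, hβ, -, h⟩ := h
  refine ⟨β / 2, by positivity, ?_⟩
  filter_upwards [h, ae_restrict_mem hΩ] with x hx hxΩ
  constructor
  · by_contra! hcon
    have := hx.1.trans (genInv_le hcon.le)
    have h2 : β ≤ β / 2 := by exact_mod_cast this
    exact (NNReal.half_lt_self hβ.ne').not_ge h2
  · refine le_of_genInv_lt (hφ.mono x hxΩ) (hx.2.trans_lt ?_)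
    rw [← ENNReal.coe_inv hβ.ne']
    exact_mod_cast inv_strictAnti₀ (by positivity) (NNReal.half_lt_self hβ.ne')

/-- Condition (A1) with the roles of the two points exchanged and the values of `φ` restricted to
powers of two. Exchanging the two almost everywhere quantifiers goes through the essential infimum
of `φ⁻¹(·, t)`, so no joint measurability is needed. -/
lemma A1.exists_forall_pow (hφ : IsWeakPhi Ω φ) (hΩ : MeasurableSet Ω) (h : A1 Ω φ) :
    ∃ β : ℝ≥0, 0 < β ∧ β < 1 ∧ ∀ (z : EuclideanSpace ℝ (Fin n)) (r : ℝ),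
      volume (Metric.ball z r) ≤ 1 →
      ∀ᵐ x ∂(volume.restrict (Metric.ball z r ∩ Ω)), ∀ k : ℕ,
        2 ^ k ≤ (volume (Metric.ball z r))⁻¹ →
        ∀ᵐ y ∂(volume.restrict (Metric.ball z r ∩ Ω)), ∀ σ : ℝ≥0,
          (2 : ℝ≥0∞) ^ k ≤ φ x (β * σ) → 2 ^ k ≤ φ y σ := by
  obtain ⟨β, hβ, hβ1, h⟩ := h
  refine ⟨β / 2, by positivity, (NNReal.half_lt_self hβ.ne').trans hβ1, fun z r hB => ?_⟩
  rcases le_or_gt r 0 with hr | hr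
  · rw [Metric.ball_eq_empty.2 hr]; simp
  set ν := volume.restrict (Metric.ball z r ∩ Ω)
  rw [ae_all_iff]
  intro k
  by_cases hk : (2 : ℝ≥0∞) ^ k ≤ (volume (Metric.ball z r))⁻¹
  swap
  · exact Eventually.of_forall fun x hk' => absurd hk' hk
  have hk1 : (1 : ℝ≥0∞) ≤ 2 ^ k := one_le_pow₀ one_le_two
  have hmem : ∀ᵐ y ∂ν, y ∈ Ω :=
    (ae_restrict_mem (measurableSet_ball.inter hΩ)).mono fun y hy => hy.2
  have hess : ∀ᵐ y ∂ν, β * genInv φ y (2 ^ k) ≤ essInf (fun y => genInv φ y (2 ^ k)) ν := by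
    filter_upwards [h z r hr hB] with y hy
    exact le_essInf_of_ae_le _ (hy.mono fun x hx => hx _ hk1 hk)
  have hess' : ∀ᵐ x ∂ν, essInf (fun y => genInv φ y (2 ^ k)) ν ≤ genInv φ x (2 ^ k) :=
    ae_essInf_le
  filter_upwards [hess', hmem] with x hx hxΩ _
  filter_upwards [hess, hmem] with y hy hyΩ σ hσ
  have hσ0 : σ ≠ 0 := by
    rintro rfl
    rw [mul_zero, hφ.map_zero x hxΩ] at hσ
    exact (zero_lt_one.trans_le hk1).not_ge hσ
  refine le_of_genInv_lt (hφ.mono y hyΩ) ?_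
  have h1 : (β : ℝ≥0∞) * genInv φ y (2 ^ k) < β * σ := by
    refine (hy.trans (hx.trans (genInv_le hσ))).trans_lt ?_
    rw [← ENNReal.coe_mul, ENNReal.coe_lt_coe]
    exact mul_lt_mul_of_pos_right (NNReal.half_lt_self hβ.ne') (pos_iff_ne_zero.2 hσ0)
  exact (ENNReal.mul_lt_mul_iff_right (by exact_mod_cast hβ.ne') ENNReal.coe_ne_top).1 h1

/-- Passing through `φ_∞`, condition (A2) compares `φ` at almost every two points, for small values
of the argument. -/
lemma A2.exists_compare (hφ : IsWeakPhi Ω φ) (hΩ : MeasurableSet Ω) (h0 : A0 Ω φ)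
    (h2 : A2 Ω φ) :
    ∃ (h : EuclideanSpace ℝ (Fin n) → ℝ≥0∞) (β t₁ : ℝ≥0),
      AEMeasurable h (volume.restrict Ω) ∧ ∫⁻ x in Ω, h x < ∞ ∧ (∀ x, h x < ∞) ∧
      0 < β ∧ 0 < t₁ ∧
      ∀ᵐ x ∂(volume.restrict Ω), ∀ᵐ y ∂(volume.restrict Ω), ∀ t ≤ t₁,
        φ x (β * t) ≤ φ y t + h y + h x := by
  obtain ⟨φi, h, β, s, hφi, hh0, hh1, -, hβ, hβ1, hs, hcomp⟩ := h2
  obtain ⟨b, hb, hb1⟩ := h0.exists_bounds hφ hΩ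
  obtain ⟨L, hL, hscale⟩ := hφ.exists_le_mul
  have hs' : (0 : ℝ≥0∞) < s := by exact_mod_cast hs
  obtain ⟨t₂, ht₂, ht₂0⟩ := ((((hφi.tendsto_zero 0 (mem_univ _)).eventually_le_const hs').and
    self_mem_nhdsWithin).exists)
  have ht₂0 : 0 < t₂ := ht₂0
  have hmono : Monotone φi := hφi.mono 0 (mem_univ _)
  have hL0 : 0 < L := zero_lt_one.trans_le hL
  set l : ℝ≥0 := min 1 (s / L) with hl
  have hl0 : 0 < l := lt_min one_pos (by positivity)
  have hLl : L * l ≤ s := by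
    calc L * l ≤ L * (s / L) := by gcongr; exact min_le_right _ _
      _ = s := mul_div_cancel₀ s hL0.ne'
  refine ⟨fun x => ENNReal.ofReal (h x), β * β, min (l * b) t₂,
    hh1.1.aemeasurable.ennreal_ofReal, ?_, fun x => ENNReal.ofReal_lt_top, by positivity,
    lt_min (by positivity) ht₂0, ?_⟩
  · exact (memLp_one_iff_integrable.1 hh1).lintegral_lt_top
  have hgood : ∀ᵐ x ∂(volume.restrict Ω), x ∈ Ω ∧ φ x b ≤ 1 ∧ ∀ t : ℝ≥0,
      (φi t ≤ s → φ x (β * t) ≤ φi t + ENNReal.ofReal (h x)) ∧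
      (φ x t ≤ s → φi (β * t) ≤ φ x t + ENNReal.ofReal (h x)) := by
    filter_upwards [hcomp, hb1, ae_restrict_mem hΩ] with x h1 h2 h3
    exact ⟨h3, h2.1, h1⟩
  filter_upwards [hgood] with x hx
  filter_upwards [hgood] with y hy t ht
  have hyt : φ y t ≤ s := by
    calc φ y t ≤ φ y (l * b) := hφ.mono y hy.1 (ht.trans (min_le_left _ _))
      _ ≤ L * l * φ y b := hscale y hy.1 l b (min_le_left _ _)
      _ ≤ L * l * 1 := by gcongr; exact hy.2.1
      _ ≤ s := by rw [mul_one]; exact_mod_cast hLl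
  have hit : φi (β * t) ≤ s := by
    refine (hmono ?_).trans ht₂
    exact (mul_le_of_le_one_left zero_le hβ1).trans (ht.trans (min_le_right _ _))
  calc φ x (β * β * t) = φ x (β * (β * t)) := by rw [mul_assoc]
    _ ≤ φi (β * t) + ENNReal.ofReal (h x) := (hx.2.2 _).1 hit
    _ ≤ _ := by gcongr; exact (hy.2.2 _).2 hyt

end GenOrlicz

/-! ### Pointwise estimates on one ball -/

namespace GenOrlicz

/-- If the mean of `F` exceeds `2 * σ`, then a bound of `V * F / σ` by `W` where `F` is larger
than `σ` bounds `V` by the mean of `W`. This plays the role of Jensen's inequality for functions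
that are only almost increasing after division by the variable. -/
lemma mul_le_lintegral_of_lt_lintegral {α : Type*} [MeasurableSpace α] {ν : Measure α}
    {m V : ℝ≥0∞} (hν : ν univ ≤ m) {F : α → ℝ≥0} {W : α → ℝ≥0∞} {σ : ℝ≥0} (hσ : 0 < σ)
    (hF : 2 * σ * m < ∫⁻ y, F y ∂ν) (h : ∀ᵐ y ∂ν, σ < F y → V * F y ≤ σ * W y) :
    V * m ≤ ∫⁻ y, W y ∂ν := by
  set F' : α → ℝ≥0∞ := {y | σ < F y}.indicator fun y => (F y : ℝ≥0∞) with hF'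
  have h1 : ∫⁻ y, F y ∂ν ≤ σ * m + ∫⁻ y, F' y ∂ν := by
    calc ∫⁻ y, F y ∂ν ≤ ∫⁻ y, (σ + F' y) ∂ν := by
          refine lintegral_mono fun y => ?_
          by_cases hy : σ < F y
          · simp only [hF', indicator_of_mem (show y ∈ {y | σ < F y} from hy)]
            exact le_add_self
          · simp only [hF', indicator_of_notMem (show y ∉ {y | σ < F y} from hy), add_zero]
            exact_mod_cast not_lt.1 hy
      _ = σ * ν univ + ∫⁻ y, F' y ∂ν := by
          rw [lintegral_add_left measurable_const, lintegral_const]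
      _ ≤ _ := by gcongr
  have h2 : σ * m ≤ ∫⁻ y, F' y ∂ν := by
    by_contra! hcon
    refine hF.not_ge (h1.trans ?_)
    calc (σ : ℝ≥0∞) * m + ∫⁻ y, F' y ∂ν ≤ σ * m + σ * m := by gcongr
      _ = 2 * σ * m := by ring
  have h3 : σ * (V * m) ≤ σ * ∫⁻ y, W y ∂ν := by
    calc (σ : ℝ≥0∞) * (V * m) = V * (σ * m) := by ring
      _ ≤ V * ∫⁻ y, F' y ∂ν := by gcongr
      _ ≤ ∫⁻ y, V * F' y ∂ν := lintegral_const_mul_le _ _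
      _ ≤ ∫⁻ y, σ * W y ∂ν := by
          refine lintegral_mono_ae ?_
          filter_upwards [h] with y hy
          by_cases hy' : σ < F y
          · simpa only [hF', indicator_of_mem (show y ∈ {y | σ < F y} from hy')] using hy hy'
          · simp [hF', indicator_of_notMem (show y ∉ {y | σ < F y} from hy')]
      _ = _ := lintegral_const_mul' _ _ ENNReal.coe_ne_top
  exact (ENNReal.mul_le_mul_iff_right (by exact_mod_cast hσ.ne') ENNReal.coe_ne_top).1 h3

lemma rpow_inv_mul_le {p : ℝ} (hp : 0 < p) {l a : ℝ≥0} {t Φ : ℝ≥0∞}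
    (h : (l : ℝ≥0∞) ^ p * t ≤ a * Φ) : (t / a) ^ p⁻¹ * l ≤ Φ ^ p⁻¹ := by
  calc (t / a) ^ p⁻¹ * l = (t / a * (l : ℝ≥0∞) ^ p) ^ p⁻¹ := by
        rw [ENNReal.mul_rpow_of_nonneg _ _ (inv_nonneg.2 hp.le), ENNReal.rpow_rpow_inv hp.ne']
    _ ≤ Φ ^ p⁻¹ := by
        gcongr
        rw [div_eq_mul_inv, mul_right_comm, ← div_eq_mul_inv, mul_comm t]
        exact ENNReal.div_le_of_le_mul' h

lemma le_mul_rpow_of_rpow_inv_mul_le {p : ℝ} (hp : 0 < p) {a : ℝ≥0} (ha : 0 < a)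
    {t m I : ℝ≥0∞} (hm : m ≠ 0) (hm' : m ≠ ∞) (h : (t / a) ^ p⁻¹ * m ≤ I) :
    t ≤ a * (m⁻¹ * I) ^ p := by
  have h1 : (t / a) ^ p⁻¹ ≤ m⁻¹ * I := by
    rw [mul_comm, ← div_eq_mul_inv]
    exact (ENNReal.le_div_iff_mul_le (Or.inl hm) (Or.inl hm')).2 h
  rw [ENNReal.rpow_inv_le_iff hp] at h1
  exact (ENNReal.div_le_iff' (by exact_mod_cast ha.ne') ENNReal.coe_ne_top).1 h1

section Ball

variable {α : Type*} [MeasurableSpace α] {ν : Measure α} {m : ℝ≥0∞} {F : α → ℝ≥0}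
  {φ : α → ℝ≥0 → ℝ≥0∞} {ψ : ℝ≥0 → ℝ≥0∞} {p : ℝ} {a K : ℝ≥0}

lemma le_mul_rpow_inv (hp : 1 < p) (hK0 : 0 < K)
    (hinc : ∀ᵐ y ∂ν, ∀ t l : ℝ≥0, K ≤ t → 1 ≤ l → (l : ℝ≥0∞) ^ p * φ y t ≤ a * φ y (l * t))
    (hK : ∀ᵐ y ∂ν, 1 ≤ φ y K) :
    ∀ᵐ y ∂ν, K < F y → (F y : ℝ≥0∞) ≤ K * (a * φ y (F y)) ∧
      (F y : ℝ≥0∞) ≤ K * (a * φ y (F y)) ^ p⁻¹ := by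
  have hp0 : 0 < p := zero_lt_one.trans hp
  filter_upwards [hinc, hK] with y h1 h2 hy
  have hl : 1 ≤ F y / K := (one_le_div hK0).2 hy.le
  have h3 := h1 K (F y / K) le_rfl hl
  have hF : (F y : ℝ≥0∞) = K * ((F y / K : ℝ≥0) : ℝ≥0∞) := by
    rw [← ENNReal.coe_mul, mul_div_cancel₀ _ hK0.ne']
  rw [div_mul_cancel₀ _ hK0.ne'] at h3
  have h4 : ((F y / K : ℝ≥0) : ℝ≥0∞) ^ p ≤ a * φ y (F y) :=
    (le_mul_of_one_le_right zero_le h2).trans h3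
  constructor
  · refine hF.trans_le (mul_le_mul_right (le_trans ?_ h4) _)
    conv_lhs => rw [← ENNReal.rpow_one ((F y / K : ℝ≥0) : ℝ≥0∞)]
    exact ENNReal.rpow_le_rpow_of_exponent_le (by exact_mod_cast hl) hp.le
  · refine hF.trans_le (mul_le_mul_right ?_ _)
    rwa [ENNReal.le_rpow_inv_iff hp0]

/-- The estimate for the part of `F` above the level `K`, when the mean `τ` of this part is large:
then the ball is small and (A1) applies. Comparing with the modular shows that the values of `φ`
which occur do not exceed the inverse of the volume of the ball. -/
lemma apply_le_of_lt_lintegral_large (hp : 1 < p) (ha : 1 ≤ a) (hK0 : 0 < K) {β : ℝ≥0}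
    (hβ : 0 < β) (hβ1 : β < 1) (hν : ν univ ≤ m) (hm : m ≠ 0) (hm' : m ≠ ∞)
    (hinc : ∀ᵐ y ∂ν, ∀ t l : ℝ≥0, K ≤ t → 1 ≤ l → (l : ℝ≥0∞) ^ p * φ y t ≤ a * φ y (l * t))
    (hK : ∀ᵐ y ∂ν, 1 ≤ φ y K) (hψ : Monotone ψ) (hψK : 1 ≤ ψ K)
    (hΦ : 2 * a * ∫⁻ y, φ y (F y) ∂ν ≤ 1)
    (hA1 : m ≤ 1 → ∀ k : ℕ, 2 ^ k ≤ m⁻¹ → ∀ᵐ y ∂ν, ∀ σ : ℝ≥0,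
      (2 : ℝ≥0∞) ^ k ≤ ψ (β * σ) → 2 ^ k ≤ φ y σ)
    {τ : ℝ≥0} (hτK : 2 * K / β < τ)
    (hτ : τ * m < ∫⁻ y, ((if K < F y then F y else 0 : ℝ≥0) : ℝ≥0∞) ∂ν) :
    ψ (β * (τ / 2)) ≤ 2 * a * (m⁻¹ * ∫⁻ y, φ y (F y) ^ p⁻¹ ∂ν) ^ p := by
  have hp0 : 0 < p := zero_lt_one.trans hp
  have ha0 : 0 < a := zero_lt_one.trans_le ha
  set I := ∫⁻ y, φ y (F y) ∂ν
  set J := ∫⁻ y, φ y (F y) ^ p⁻¹ ∂ν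
  set σ := τ / 2 with hσ
  have hKβ : K ≤ β * σ := by
    have := (div_lt_iff₀ hβ).1 hτK
    rw [hσ, ← mul_div_assoc, le_div_iff₀ two_pos, mul_comm K, mul_comm β]
    exact this.le
  have hKσ : K ≤ σ := hKβ.trans (mul_le_of_le_one_left zero_le hβ1.le)
  have hσ0 : 0 < σ := hK0.trans_le hKσ
  have hKτ : K ≤ τ := hKσ.trans (by rw [hσ]; exact half_le_self zero_le)
  have haI : a * I ≤ 1 := by
    refine le_trans ?_ hΦ
    rw [mul_assoc]
    exact le_mul_of_one_le_left zero_le one_le_two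
  have hm1 : m ≤ 1 := by
    have h1 : τ * m ≤ K * 1 := by
      calc τ * m ≤ ∫⁻ y, ((if K < F y then F y else 0 : ℝ≥0) : ℝ≥0∞) ∂ν := hτ.le
        _ ≤ ∫⁻ y, K * (a * φ y (F y)) ∂ν := by
            refine lintegral_mono_ae ?_
            filter_upwards [le_mul_rpow_inv hp hK0 hinc hK] with y hy
            split_ifs with h
            · exact (hy h).1
            · simp
        _ = K * (a * I) := by
            rw [lintegral_const_mul' _ _ ENNReal.coe_ne_top,
              lintegral_const_mul' _ _ ENNReal.coe_ne_top]
        _ ≤ K * 1 := by gcongr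
    have h2 : (K : ℝ≥0∞) * m ≤ K * 1 := le_trans (by gcongr) h1
    exact (ENNReal.mul_le_mul_iff_right (by exact_mod_cast hK0.ne') ENNReal.coe_ne_top).1 h2
  have hminv : (1 : ℝ≥0∞) ≤ m⁻¹ := ENNReal.one_le_inv.2 hm1
  -- A power of two below both `ψ (β * σ)` and `1 / m` is controlled by the means over the ball.
  have hstep : ∀ k : ℕ, (2 : ℝ≥0∞) ^ k ≤ ψ (β * σ) → 2 ^ k ≤ m⁻¹ →
      (2 : ℝ≥0∞) ^ k ≤ a * (m⁻¹ * J) ^ p ∧ (2 : ℝ≥0∞) ^ k * m ≤ a * I := by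
    intro k hk hkm
    have hpt : ∀ᵐ y ∂ν, σ < (if K < F y then F y else 0) → (if K < F y then F y else 0) = F y ∧
        1 ≤ F y / σ ∧ ((F y / σ : ℝ≥0) : ℝ≥0∞) ^ p * 2 ^ k ≤ a * φ y (F y) := by
      filter_upwards [hA1 hm1 k hkm, hinc] with y h1 h2 hy
      split_ifs at hy ⊢ with h
      · have hl : 1 ≤ F y / σ := (one_le_div hσ0).2 hy.le
        refine ⟨rfl, hl, ?_⟩
        calc ((F y / σ : ℝ≥0) : ℝ≥0∞) ^ p * 2 ^ k ≤ ((F y / σ : ℝ≥0) : ℝ≥0∞) ^ p * φ y σ := by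
              gcongr; exact h1 σ hk
          _ ≤ a * φ y (F y / σ * σ) := h2 σ _ hKσ hl
          _ = _ := by rw [div_mul_cancel₀ _ hσ0.ne']
      · exact absurd hy not_lt_zero
    have hF : ∀ y, (F y : ℝ≥0∞) = ((F y / σ : ℝ≥0) : ℝ≥0∞) * σ := fun y => by
      rw [← ENNReal.coe_mul, div_mul_cancel₀ _ hσ0.ne']
    have hτ' : 2 * σ * m < ∫⁻ y, ((if K < F y then F y else 0 : ℝ≥0) : ℝ≥0∞) ∂ν := by
      convert hτ using 2
      rw [hσ]
      norm_cast
      exact mul_div_cancel₀ _ two_ne_zero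
    constructor
    · refine le_mul_rpow_of_rpow_inv_mul_le hp0 ha0 hm hm' ?_
      refine mul_le_lintegral_of_lt_lintegral hν hσ0 hτ' ?_
      filter_upwards [hpt] with y hy hy'
      obtain ⟨h1, -, h3⟩ := hy hy'
      rw [h1, hF y, ← mul_assoc, mul_comm (σ : ℝ≥0∞)]
      gcongr
      exact rpow_inv_mul_le hp0 h3
    · rw [← lintegral_const_mul' _ _ ENNReal.coe_ne_top]
      refine mul_le_lintegral_of_lt_lintegral hν hσ0 hτ' ?_
      filter_upwards [hpt] with y hy hy'
      obtain ⟨h1, h2, h3⟩ := hy hy'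
      rw [h1, hF y, ← mul_assoc, mul_comm (σ : ℝ≥0∞)]
      refine mul_le_mul_left (le_trans ?_ h3) _
      rw [mul_comm]
      gcongr
      conv_lhs => rw [← ENNReal.rpow_one ((F y / σ : ℝ≥0) : ℝ≥0∞)]
      exact ENNReal.rpow_le_rpow_of_exponent_le (by exact_mod_cast h2) hp.le
  set w : ℝ≥0∞ := min (ψ (β * σ)) m⁻¹ with hw
  have hw1 : 1 ≤ w := le_min (hψK.trans (hψ hKβ)) hminv
  have hwtop : w ≠ ∞ := ((min_le_right _ _).trans_lt (ENNReal.inv_lt_top.2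
    (pos_iff_ne_zero.2 hm))).ne
  obtain ⟨k, hk1, hk2⟩ := exists_nat_pow_near (x := w.toNNReal) (y := (2 : ℝ≥0))
    (by rw [← ENNReal.coe_le_coe, ENNReal.coe_toNNReal hwtop]; exact_mod_cast hw1) one_lt_two
  rw [← ENNReal.coe_le_coe, ENNReal.coe_toNNReal hwtop] at hk1
  rw [← ENNReal.coe_lt_coe, ENNReal.coe_toNNReal hwtop] at hk2
  push_cast at hk1 hk2
  obtain ⟨h1, h2⟩ := hstep k (hk1.trans (min_le_left _ _)) (hk1.trans (min_le_right _ _))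
  have h3 : w < m⁻¹ := by
    refine hk2.trans_le ?_
    rw [pow_succ, ENNReal.le_inv_iff_mul_le]
    calc (2 : ℝ≥0∞) ^ k * 2 * m = 2 * (2 ^ k * m) := by ring
      _ ≤ 2 * (a * I) := by gcongr
      _ = 2 * a * I := by ring
      _ ≤ 1 := hΦ
  have h4 : w = ψ (β * σ) := by
    rw [hw, min_eq_left_iff]
    by_contra! hcon
    rw [hw, min_eq_right hcon.le] at h3
    exact h3.false
  calc ψ (β * σ) = w := h4.symm
    _ ≤ 2 ^ (k + 1) := hk2.le
    _ = 2 * 2 ^ k := pow_succ' _ _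
    _ ≤ 2 * (a * (m⁻¹ * J) ^ p) := by gcongr
    _ = _ := by ring

/-- The estimate for the part of `F` below the level `K`, at a point where `(aInc)_p` holds for all
arguments; the function `ψ` at this point is compared with `φ y` by means of (A2). -/
lemma apply_le_of_lt_lintegral_small (hp : 1 < p) (ha : 1 ≤ a) {β κ t₁ : ℝ≥0}
    (hβ : 0 < β) (hκ : 0 < κ) (hκ1 : κ ≤ 1) (hκK : κ * K ≤ t₁)
    (hν : ν univ ≤ m) (hm : m ≠ 0) (hm' : m ≠ ∞)
    (hmono : ∀ᵐ y ∂ν, Monotone (φ y))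
    (hinc : ∀ t l : ℝ≥0, 0 < t → 1 ≤ l → (l : ℝ≥0∞) ^ p * ψ t ≤ a * ψ (l * t))
    {h : α → ℝ≥0∞} {c : ℝ≥0∞}
    (hcmp : ∀ᵐ y ∂ν, ∀ t ≤ t₁, ψ (β * t) ≤ φ y t + h y + c)
    {τ : ℝ≥0} (hτ0 : 0 < τ)
    (hτ : τ * m < ∫⁻ y, ((if K < F y then 0 else F y : ℝ≥0) : ℝ≥0∞) ∂ν) :
    ψ (β * (κ * (τ / 2))) ≤
      a * 2 ^ (p - 1) * ((m⁻¹ * ∫⁻ y, (φ y (F y) + h y) ^ p⁻¹ ∂ν) ^ p + c) := by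
  have hp0 : 0 < p := zero_lt_one.trans hp
  have ha0 : 0 < a := zero_lt_one.trans_le ha
  set J := ∫⁻ y, (φ y (F y) + h y) ^ p⁻¹ ∂ν with hJ
  set σ := τ / 2 with hσ
  have hσ0 : 0 < σ := by positivity
  have hτ' : 2 * σ * m < ∫⁻ y, ((if K < F y then 0 else F y : ℝ≥0) : ℝ≥0∞) ∂ν := by
    convert hτ using 2
    rw [hσ]
    norm_cast
    exact mul_div_cancel₀ _ two_ne_zero
  have hmain : (ψ (β * (κ * σ)) / a) ^ p⁻¹ * m ≤
      ∫⁻ y, ((φ y (F y) + h y) ^ p⁻¹ + c ^ p⁻¹) ∂ν := by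
    refine mul_le_lintegral_of_lt_lintegral hν hσ0 hτ' ?_
    filter_upwards [hcmp, hmono] with y h1 h2 hy
    split_ifs at hy ⊢ with hKF
    · exact absurd hy not_lt_zero
    have hl : 1 ≤ F y / σ := (one_le_div hσ0).2 hy.le
    have hF : (F y : ℝ≥0∞) = ((F y / σ : ℝ≥0) : ℝ≥0∞) * σ := by
      rw [← ENNReal.coe_mul, div_mul_cancel₀ _ hσ0.ne']
    have hκF : κ * F y ≤ t₁ := le_trans (by gcongr; exact not_lt.1 hKF) hκK
    rw [hF, ← mul_assoc, mul_comm (σ : ℝ≥0∞)]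
    gcongr
    refine le_trans ?_ (ENNReal.rpow_add_le_add_rpow _ _ (inv_nonneg.2 hp0.le)
      (inv_le_one_of_one_le₀ hp.le))
    refine rpow_inv_mul_le hp0 ((hinc _ _ (by positivity) hl).trans ?_)
    gcongr
    calc ψ (F y / σ * (β * (κ * σ))) = ψ (β * (κ * F y)) := by
          congr 1
          field_simp
      _ ≤ φ y (κ * F y) + h y + c := h1 _ hκF
      _ ≤ φ y (F y) + h y + c := by
          gcongr
          exact h2 (mul_le_of_le_one_left zero_le hκ1)
  have hmain' := le_mul_rpow_of_rpow_inv_mul_le hp0 ha0 hm hm' hmain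
  refine hmain'.trans ?_
  rw [mul_assoc]
  gcongr
  calc (m⁻¹ * ∫⁻ y, ((φ y (F y) + h y) ^ p⁻¹ + c ^ p⁻¹) ∂ν) ^ p
      ≤ (m⁻¹ * J + c ^ p⁻¹) ^ p := by
        gcongr
        rw [lintegral_add_right _ measurable_const, lintegral_const, mul_add]
        gcongr
        calc m⁻¹ * (c ^ p⁻¹ * ν univ) ≤ m⁻¹ * (c ^ p⁻¹ * m) := by gcongr
          _ = c ^ p⁻¹ * (m⁻¹ * m) := by ring
          _ = c ^ p⁻¹ := by rw [ENNReal.inv_mul_cancel hm hm', mul_one]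
    _ ≤ 2 ^ (p - 1) * ((m⁻¹ * J) ^ p + (c ^ p⁻¹) ^ p) :=
        ENNReal.rpow_add_le_mul_rpow_add_rpow _ _ hp.le
    _ = _ := by rw [ENNReal.rpow_inv_rpow hp0.ne']

/-- The estimate on one ball. The term `θ` accounts for the points where `(aInc)_p` is only known
for large arguments; there, the means of the small values of `F` are merely bounded. -/
lemma apply_le_of_lt_lintegral (hp : 1 < p) (ha : 1 ≤ a) (hK0 : 0 < K) {β : ℝ≥0}
    (hβ : 0 < β) (hβ1 : β < 1) {β' κ t₁ : ℝ≥0} (hβ' : 0 < β') (hκ : 0 < κ) (hκ1 : κ ≤ 1)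
    (hκK : κ * K ≤ t₁) (hν : ν univ ≤ m) (hm : m ≠ 0) (hm' : m ≠ ∞)
    (hmono : ∀ᵐ y ∂ν, Monotone (φ y))
    (hinc : ∀ᵐ y ∂ν, ∀ t l : ℝ≥0, K ≤ t → 1 ≤ l → (l : ℝ≥0∞) ^ p * φ y t ≤ a * φ y (l * t))
    (hK : ∀ᵐ y ∂ν, 1 ≤ φ y K) (hψ : Monotone ψ) (hψ0 : ψ 0 = 0) (hψK : 1 ≤ ψ K)
    {b : ℝ≥0} (hψb : ψ b ≤ 1) {θ : ℝ≥0∞}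
    (hθ : θ = 1 ∨ ∀ t l : ℝ≥0, 0 < t → 1 ≤ l → (l : ℝ≥0∞) ^ p * ψ t ≤ a * ψ (l * t))
    (hΦ : 2 * a * ∫⁻ y, φ y (F y) ∂ν ≤ 1)
    (hA1 : m ≤ 1 → ∀ k : ℕ, 2 ^ k ≤ m⁻¹ → ∀ᵐ y ∂ν, ∀ σ : ℝ≥0,
      (2 : ℝ≥0∞) ^ k ≤ ψ (β * σ) → 2 ^ k ≤ φ y σ)
    {h : α → ℝ≥0∞} {c : ℝ≥0∞} (hcmp : ∀ᵐ y ∂ν, ∀ t ≤ t₁, ψ (β' * t) ≤ φ y t + h y + c)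
    {ε : ℝ≥0} (hε₁ : ε ≤ β / 2) (hε₂ : ε * (2 * K / β) ≤ b) (hε₃ : ε ≤ β' * κ / 2)
    (hF : AEMeasurable F ν) {τ : ℝ≥0} (hτ : 2 * τ * m < ∫⁻ y, F y ∂ν) :
    ψ (ε * τ) ≤ (2 * a + a * a + a * 2 ^ (p - 1)) *
      ((m⁻¹ * ∫⁻ y, (φ y (F y) + h y) ^ p⁻¹ ∂ν) ^ p + c) + θ := by
  have hp0 : 0 < p := zero_lt_one.trans hp
  rcases eq_or_ne τ 0 with rfl | hτ0
  · simp [hψ0]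
  have hτ0 : 0 < τ := pos_iff_ne_zero.2 hτ0
  set K' := 2 * K / β with hK'
  have hKK' : K ≤ K' := by
    rw [hK', le_div_iff₀ hβ]
    calc K * β ≤ K * 1 := by gcongr
      _ ≤ 2 * K := by rw [mul_one, two_mul]; exact le_self_add
  have hK'0 : 0 < K' := hK0.trans_le hKK'
  set A := m⁻¹ * ∫⁻ y, (φ y (F y) + h y) ^ p⁻¹ ∂ν with hA
  have hAΦ : m⁻¹ * ∫⁻ y, φ y (F y) ^ p⁻¹ ∂ν ≤ A := by
    rw [hA]
    gcongr
    exact le_self_add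
  have hmeas : AEMeasurable
      (fun y => ((if K < F y then F y else 0 : ℝ≥0) : ℝ≥0∞)) ν := by
    have h1 : Measurable fun t : ℝ≥0 => ((if K < t then t else 0 : ℝ≥0) : ℝ≥0∞) :=
      (Measurable.ite measurableSet_Ioi measurable_id measurable_const).coe_nnreal_ennreal
    exact h1.comp_aemeasurable hF
  have hsplit : ∫⁻ y, F y ∂ν = ∫⁻ y, ((if K < F y then F y else 0 : ℝ≥0) : ℝ≥0∞) ∂ν +
      ∫⁻ y, ((if K < F y then 0 else F y : ℝ≥0) : ℝ≥0∞) ∂ν := by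
    rw [← lintegral_add_left' hmeas]
    refine lintegral_congr fun y => ?_
    split_ifs <;> simp
  have hor : τ * m < ∫⁻ y, ((if K < F y then F y else 0 : ℝ≥0) : ℝ≥0∞) ∂ν ∨
      τ * m < ∫⁻ y, ((if K < F y then 0 else F y : ℝ≥0) : ℝ≥0∞) ∂ν := by
    by_contra! hcon
    refine hτ.not_ge (hsplit.trans_le ((add_le_add hcon.1 hcon.2).trans_eq ?_))
    ring
  rcases hor with hl | hs
  · rcases lt_or_ge K' τ with hKτ | hKτ
    · calc ψ (ε * τ) ≤ ψ (β * (τ / 2)) := hψ (by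
            calc ε * τ ≤ β / 2 * τ := by gcongr
              _ = β * (τ / 2) := by ring)
        _ ≤ 2 * a * (m⁻¹ * ∫⁻ y, φ y (F y) ^ p⁻¹ ∂ν) ^ p :=
            apply_le_of_lt_lintegral_large hp ha hK0 hβ hβ1 hν hm hm' hinc hK hψ hψK hΦ hA1
              hKτ hl
        _ ≤ (2 * a + a * a + a * 2 ^ (p - 1)) * (A ^ p + c) + θ := by
            refine le_add_right (mul_le_mul' ?_ (le_add_right (by gcongr)))
            rw [add_assoc]; exact le_self_add
    · rcases hθ with rfl | hθ
      · refine le_add_left ((hψ ?_).trans hψb)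
        exact le_trans (by gcongr) hε₂
      · have hτA : (τ : ℝ≥0∞) ≤ K * (a : ℝ≥0∞) ^ p⁻¹ * A := by
          calc (τ : ℝ≥0∞) ≤ m⁻¹ * ∫⁻ y, ((if K < F y then F y else 0 : ℝ≥0) : ℝ≥0∞) ∂ν := by
                rw [mul_comm, ← div_eq_mul_inv]
                exact (ENNReal.le_div_iff_mul_le (Or.inl hm) (Or.inl hm')).2 hl.le
            _ ≤ m⁻¹ * ∫⁻ y, K * (a : ℝ≥0∞) ^ p⁻¹ * φ y (F y) ^ p⁻¹ ∂ν := by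
                refine mul_le_mul_right (lintegral_mono_ae ?_) _
                filter_upwards [le_mul_rpow_inv hp hK0 hinc hK] with y hy
                split_ifs with hKF
                · refine (hy hKF).2.trans_eq ?_
                  rw [ENNReal.mul_rpow_of_nonneg _ _ (inv_nonneg.2 hp0.le), mul_assoc]
                · simp
            _ = K * (a : ℝ≥0∞) ^ p⁻¹ * (m⁻¹ * ∫⁻ y, φ y (F y) ^ p⁻¹ ∂ν) := by
                rw [lintegral_const_mul']
                · ring
                · exact ENNReal.mul_ne_top ENNReal.coe_ne_top
                    (ENNReal.rpow_ne_top_of_nonneg (inv_nonneg.2 hp0.le) ENNReal.coe_ne_top)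
            _ ≤ _ := by gcongr
        have hl1 : 1 ≤ K' / τ := (one_le_div hτ0).2 hKτ
        rcases eq_or_ne ε 0 with rfl | hε0
        · simp [hψ0]
        have h1 := hθ (ε * τ) (K' / τ) (by positivity) hl1
        have h2 : K' / τ * (ε * τ) = ε * K' := by field_simp
        have h3 : ((K' / τ : ℝ≥0) : ℝ≥0∞) ^ p * ψ (ε * τ) ≤ a := by
          refine h1.trans ?_
          rw [h2]
          exact mul_le_of_le_one_right zero_le ((hψ hε₂).trans hψb)
        have h4 : (((τ / K' : ℝ≥0) : ℝ≥0∞) ^ p) * ((K' / τ : ℝ≥0) : ℝ≥0∞) ^ p = 1 := by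
          rw [← ENNReal.mul_rpow_of_nonneg _ _ hp0.le, ← ENNReal.coe_mul]
          rw [show τ / K' * (K' / τ) = 1 by field_simp]
          simp
        calc ψ (ε * τ) = ((τ / K' : ℝ≥0) : ℝ≥0∞) ^ p * (((K' / τ : ℝ≥0) : ℝ≥0∞) ^ p *
              ψ (ε * τ)) := by rw [← mul_assoc, h4, one_mul]
          _ ≤ ((τ / K' : ℝ≥0) : ℝ≥0∞) ^ p * a := by gcongr
          _ ≤ ((a : ℝ≥0∞) ^ p⁻¹ * A) ^ p * a := by
              gcongr
              rw [ENNReal.coe_div hK'0.ne']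
              refine ENNReal.div_le_of_le_mul' (hτA.trans ?_)
              rw [mul_assoc]
              gcongr
          _ = a * a * A ^ p := by
              rw [ENNReal.mul_rpow_of_nonneg _ _ hp0.le, ENNReal.rpow_inv_rpow hp0.ne']; ring
          _ ≤ (2 * a + a * a + a * 2 ^ (p - 1)) * (A ^ p + c) + θ := by
              refine le_add_right (mul_le_mul' ?_ le_self_add)
              rw [add_right_comm]; exact le_add_self
  · rcases hθ with rfl | hθ
    · refine le_add_left ((hψ ?_).trans hψb)
      refine le_trans ?_ hε₂
      gcongr
      refine le_trans ?_ hKK'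
      have h1 : τ * m ≤ K * m := by
        refine hs.le.trans ?_
        calc ∫⁻ y, ((if K < F y then 0 else F y : ℝ≥0) : ℝ≥0∞) ∂ν ≤ ∫⁻ y, K ∂ν := by
              refine lintegral_mono fun y => ?_
              split_ifs with hKF
              · simp
              · exact ENNReal.coe_le_coe.2 (not_lt.1 hKF)
          _ = K * ν univ := lintegral_const _
          _ ≤ K * m := by gcongr
      exact_mod_cast (ENNReal.mul_le_mul_iff_left hm hm').1 h1
    · calc ψ (ε * τ) ≤ ψ (β' * (κ * (τ / 2))) := hψ (by
            calc ε * τ ≤ β' * κ / 2 * τ := by gcongr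
              _ = β' * (κ * (τ / 2)) := by ring)
        _ ≤ a * 2 ^ (p - 1) * (A ^ p + c) :=
            apply_le_of_lt_lintegral_small hp ha hβ' hκ hκ1 hκK hν hm hm' hmono hθ hcmp hτ0 hs
        _ ≤ (2 * a + a * a + a * 2 ^ (p - 1)) * (A ^ p + c) + θ := by
            refine le_add_right (mul_le_mul' le_add_self le_rfl)

end Ball

end GenOrlicz

/-! ### Boundedness of the maximal operator -/

namespace GenOrlicz

variable {n : ℕ} {Ω : Set (EuclideanSpace ℝ (Fin n))}
  {φ : EuclideanSpace ℝ (Fin n) → ℝ≥0 → ℝ≥0∞}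

lemma setLIntegral_ball_indicator (hΩ : MeasurableSet Ω) (g : EuclideanSpace ℝ (Fin n) → ℝ≥0∞)
    (z : EuclideanSpace ℝ (Fin n)) (r : ℝ) :
    ∫⁻ y in Metric.ball z r, Ω.indicator g y = ∫⁻ y in Metric.ball z r ∩ Ω, g y := by
  rw [lintegral_indicator hΩ, Measure.restrict_restrict hΩ, inter_comm]

lemma maximal_eq_ballMax (hΩ : MeasurableSet Ω) (f : EuclideanSpace ℝ (Fin n) → ℝ) :
    maximal Ω f = ballMax volume (Ω.indicator fun y => (‖f y‖₊ : ℝ≥0∞)) := by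
  funext x
  simp only [maximal, ballMax, setLIntegral_ball_indicator hΩ]

/-- The pointwise estimate of `φ(x, ε M f)` for functions of modular at most one. The function `h`
comes from (A2), and `G` is the set of points at which `(aInc)_p` may fail for small arguments. -/
lemma exists_apply_le_ballMax (hn : 1 ≤ n) (hΩ : MeasurableSet Ω) (hφ : IsWeakPhi Ω φ)
    (hA0 : A0 Ω φ) (hA1 : A1 Ω φ) (hA2 : A2 Ω φ) {p : ℝ} (hp : 1 < p) {a t₀ : ℝ≥0} (ha : 1 ≤ a)
    (hinf : ∀ᵐ x ∂(volume.restrict Ω), ∀ t l : ℝ≥0, t₀ ≤ t → 1 ≤ l →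
      (l : ℝ≥0∞) ^ p * φ x t ≤ a * φ x (l * t))
    {G : Set (EuclideanSpace ℝ (Fin n))}
    (hG : ∀ᵐ x ∂(volume.restrict Ω), x ∉ G → ∀ t l : ℝ≥0, 0 < t → 1 ≤ l →
      (l : ℝ≥0∞) ^ p * φ x t ≤ a * φ x (l * t)) :
    ∃ (h : EuclideanSpace ℝ (Fin n) → ℝ≥0∞) (ε : ℝ≥0) (C : ℝ≥0∞),
      AEMeasurable h (volume.restrict Ω) ∧ ∫⁻ x in Ω, h x < ∞ ∧ (∀ x, h x < ∞) ∧
      0 < ε ∧ C ≠ ∞ ∧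
      ∀ f : EuclideanSpace ℝ (Fin n) → ℝ, AEMeasurable f (volume.restrict Ω) →
        modular Ω φ f ≤ 1 → ∀ᵐ x ∂(volume.restrict Ω), ∀ τ : ℝ≥0, τ < maximal Ω f x →
          φ x (ε * τ) ≤ C * (ballMax volume (Ω.indicator fun y =>
            (φ y ‖f y‖₊ + h y) ^ p⁻¹) x ^ p + h x) + G.indicator (fun _ => 1) x := by
  have hne : Nonempty (Fin n) := ⟨⟨0, hn⟩⟩
  have hp0 : 0 < p := zero_lt_one.trans hp
  obtain ⟨L, hL, hscale⟩ := hφ.exists_le_mul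
  obtain ⟨b, hb, hb1⟩ := hA0.exists_bounds hφ hΩ
  obtain ⟨β, hβ, hβ1, hA1'⟩ := hA1.exists_forall_pow hφ hΩ
  obtain ⟨h, β', t₁, hhm, hhI, hhtop, hβ', ht₁, hcmp⟩ := hA2.exists_compare hφ hΩ hA0
  have ha0 : 0 < a := zero_lt_one.trans_le ha
  have hL0 : 0 < L := zero_lt_one.trans_le hL
  set K : ℝ≥0 := max t₀ b⁻¹ with hK
  have hK0 : 0 < K := lt_max_of_lt_right (inv_pos.2 hb)
  set κ : ℝ≥0 := min 1 (t₁ / K) with hκ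
  have hκ0 : 0 < κ := lt_min one_pos (by positivity)
  have hκK : κ * K ≤ t₁ := by
    calc κ * K ≤ t₁ / K * K := by gcongr; exact min_le_right _ _
      _ = t₁ := div_mul_cancel₀ _ hK0.ne'
  -- The factor that makes the modular small enough for the use of (A1).
  set η : ℝ≥0 := (2 * a * L)⁻¹ with hη
  have hη0 : 0 < η := by positivity
  have hη1 : η ≤ 1 := by
    refine inv_le_one_of_one_le₀ ?_
    calc (1 : ℝ≥0) = 1 * 1 * 1 := by norm_num
      _ ≤ 2 * a * L := by gcongr; norm_num
  set δ : ℝ≥0 := min (β / 2) (min (b / (2 * K / β)) (β' * κ / 2)) with hδ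
  have hδ0 : 0 < δ := by
    refine lt_min (by positivity) (lt_min (by positivity) (by positivity))
  have hδ₁ : δ ≤ β / 2 := min_le_left _ _
  have hδ₂ : δ * (2 * K / β) ≤ b := by
    refine (le_div_iff₀ (by positivity)).1 ?_
    exact (min_le_right _ _).trans (min_le_left _ _)
  have hδ₃ : δ ≤ β' * κ / 2 := (min_le_right _ _).trans (min_le_right _ _)
  refine ⟨h, δ * (η / 2 ^ (n + 1)), 2 * a + a * a + a * 2 ^ (p - 1), hhm, hhI, hhtop,
    by positivity, ?_, ?_⟩
  · finiteness
  intro f hf hmod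
  -- The points at which all the pointwise conditions hold.
  have hgood : ∀ᵐ x ∂(volume.restrict Ω), x ∈ Ω ∧ (φ x b ≤ 1 ∧ 1 ≤ φ x K) ∧
      ∀ t l : ℝ≥0, K ≤ t → 1 ≤ l → (l : ℝ≥0∞) ^ p * φ x t ≤ a * φ x (l * t) := by
    filter_upwards [ae_restrict_mem hΩ, hb1, hinf] with x h1 h2 h3
    exact ⟨h1, ⟨h2.1, h2.2.trans (hφ.mono x h1 (le_max_right _ _))⟩,
      fun t l ht hl => h3 t l ((le_max_left _ _).trans ht) hl⟩
  have hballs : ∀ᵐ x ∂(volume.restrict Ω), ∀ (i : ℕ) (q : ℚ),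
      x ∈ Metric.ball (TopologicalSpace.denseSeq (EuclideanSpace ℝ (Fin n)) i) q →
      volume (Metric.ball (TopologicalSpace.denseSeq (EuclideanSpace ℝ (Fin n)) i) q) ≤ 1 →
      ∀ k : ℕ, 2 ^ k ≤
        (volume (Metric.ball (TopologicalSpace.denseSeq (EuclideanSpace ℝ (Fin n)) i) q))⁻¹ →
        ∀ᵐ y ∂(volume.restrict (Metric.ball (TopologicalSpace.denseSeq
          (EuclideanSpace ℝ (Fin n)) i) q ∩ Ω)), ∀ σ : ℝ≥0,
          (2 : ℝ≥0∞) ^ k ≤ φ x (β * σ) → 2 ^ k ≤ φ y σ := by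
    rw [ae_all_iff]; intro i
    rw [ae_all_iff]; intro q
    by_cases hv : volume (Metric.ball
        (TopologicalSpace.denseSeq (EuclideanSpace ℝ (Fin n)) i) (q : ℝ)) ≤ 1
    swap
    · exact Eventually.of_forall fun x _ hv' => absurd hv' hv
    have h1 := hA1' _ _ hv
    rw [ae_restrict_iff'₀ (measurableSet_ball.inter hΩ).nullMeasurableSet] at h1
    rw [ae_restrict_iff'₀ hΩ.nullMeasurableSet]
    filter_upwards [h1] with x hx hxΩ hxB _ using hx ⟨hxB, hxΩ⟩
  filter_upwards [hgood, hballs, hcmp, hG] with x hx hxB hxc hxG τ hτ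
  obtain ⟨hxΩ, ⟨hxb, hxK⟩, -⟩ := hx
  rw [maximal_eq_ballMax hΩ] at hτ
  obtain ⟨z, r, hxz, hτB⟩ := lt_ballMax_iff.1 hτ
  obtain ⟨i, q, hsub, hvol⟩ := exists_ball_superset (μ := volume) z (Metric.pos_of_mem_ball hxz)
  set B := Metric.ball (TopologicalSpace.denseSeq (EuclideanSpace ℝ (Fin n)) i) (q : ℝ) with hB
  have hxB' : x ∈ B := hsub hxz
  have hBm : volume B ≠ 0 := measure_ball_ne_zero_of_mem hxB'
  have hBm' : volume B ≠ ∞ := measure_ball_lt_top.ne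
  set ν := volume.restrict (B ∩ Ω) with hν
  have hνΩ : ν ≤ volume.restrict Ω := Measure.restrict_mono_set _ inter_subset_right
  have hac : ∀ {P : EuclideanSpace ℝ (Fin n) → Prop}, (∀ᵐ y ∂(volume.restrict Ω), P y) →
      ∀ᵐ y ∂ν, P y := fun hP => ae_mono hνΩ hP
  have hνuniv : ν univ ≤ volume B := by
    rw [hν, Measure.restrict_apply_univ]; exact measure_mono inter_subset_left
  have hFle : ∀ᵐ y ∂ν, φ y (η * ‖f y‖₊) ≤ φ y ‖f y‖₊ := by
    filter_upwards [hac hgood] with y hy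
    exact hφ.mono y hy.1 (mul_le_of_le_one_left zero_le hη1)
  have hΦ : 2 * a * ∫⁻ y, φ y (η * ‖f y‖₊) ∂ν ≤ 1 := by
    calc 2 * a * ∫⁻ y, φ y (η * ‖f y‖₊) ∂ν ≤ 2 * a * ∫⁻ y, L * η * φ y ‖f y‖₊ ∂ν := by
          refine mul_le_mul_right (lintegral_mono_ae ?_) _
          filter_upwards [hac hgood] with y hy
          exact hscale y hy.1 _ _ hη1
      _ ≤ 2 * a * (L * η * modular Ω φ f) := by
          rw [lintegral_const_mul' _ _ (by finiteness)]
          gcongr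
          exact lintegral_mono' hνΩ le_rfl
      _ ≤ 2 * a * (L * η * 1) := by gcongr
      _ = ((2 * a * L * η : ℝ≥0) : ℝ≥0∞) := by push_cast; ring
      _ = 1 := by rw [hη, mul_inv_cancel₀ (by positivity)]; rfl
  have hτ' : 2 * ((η / 2 ^ (n + 1) * τ : ℝ≥0) : ℝ≥0∞) * volume B <
      ∫⁻ y, ((η * ‖f y‖₊ : ℝ≥0) : ℝ≥0∞) ∂ν := by
    have h1 : τ * volume (Metric.ball z r) < ∫⁻ y, ‖f y‖₊ ∂ν := by
      calc τ * volume (Metric.ball z r) < ∫⁻ y in Metric.ball z r,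
            Ω.indicator (fun y => (‖f y‖₊ : ℝ≥0∞)) y := by
            rw [mul_comm (_⁻¹), ← div_eq_mul_inv] at hτB
            exact (ENNReal.lt_div_iff_mul_lt (Or.inl (measure_ball_ne_zero_of_mem hxz))
              (Or.inl measure_ball_lt_top.ne)).1 hτB
        _ ≤ ∫⁻ y, ‖f y‖₊ ∂ν := by
            rw [setLIntegral_ball_indicator hΩ]
            exact lintegral_mono_set (inter_subset_inter_left _ hsub)
    have h2 : ∫⁻ y, ((η * ‖f y‖₊ : ℝ≥0) : ℝ≥0∞) ∂ν = η * ∫⁻ y, ‖f y‖₊ ∂ν := by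
      simp only [ENNReal.coe_mul]
      exact lintegral_const_mul' _ _ ENNReal.coe_ne_top
    rw [h2]
    rw [finrank_euclideanSpace_fin] at hvol
    have h3 : 2 * (η / 2 ^ (n + 1) * τ) * 2 ^ n = η * τ := by
      rw [pow_succ]; field_simp
    calc 2 * ((η / 2 ^ (n + 1) * τ : ℝ≥0) : ℝ≥0∞) * volume B
        ≤ 2 * ((η / 2 ^ (n + 1) * τ : ℝ≥0) : ℝ≥0∞) * (2 ^ n * volume (Metric.ball z r)) := by
          gcongr
      _ = ((2 * (η / 2 ^ (n + 1) * τ) * 2 ^ n : ℝ≥0) : ℝ≥0∞) * volume (Metric.ball z r) := by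
          push_cast; ring
      _ = η * (τ * volume (Metric.ball z r)) := by rw [h3]; push_cast; ring
      _ < η * ∫⁻ y, ‖f y‖₊ ∂ν :=
          (ENNReal.mul_lt_mul_iff_right (by exact_mod_cast hη0.ne') ENNReal.coe_ne_top).2 h1
  have hFm : AEMeasurable (fun y => η * ‖f y‖₊) ν :=
    (hf.mono_measure hνΩ).nnnorm.const_mul η
  have hθ : G.indicator (fun _ => (1 : ℝ≥0∞)) x = 1 ∨
      ∀ t l : ℝ≥0, 0 < t → 1 ≤ l → (l : ℝ≥0∞) ^ p * φ x t ≤ a * φ x (l * t) := by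
    by_cases hxG' : x ∈ G
    · exact Or.inl (indicator_of_mem hxG' _)
    · exact Or.inr (hxG hxG')
  have hkey := apply_le_of_lt_lintegral (F := fun y => η * ‖f y‖₊) (φ := φ) (ψ := φ x) hp ha hK0
    hβ hβ1 hβ' hκ0 (min_le_left _ _) hκK hνuniv hBm hBm'
    (hac (hgood.mono fun y hy => hφ.mono y hy.1)) (hac (hgood.mono fun y hy => hy.2.2))
    (hac (hgood.mono fun y hy => hy.2.1.2)) (hφ.mono x hxΩ) (hφ.map_zero x hxΩ) hxK hxb hθ hΦ
    (fun hv k hk => hxB i q hxB' hv k hk) (hac hxc) hδ₁ hδ₂ hδ₃ hFm hτ'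
  rw [mul_assoc]
  refine hkey.trans ?_
  gcongr
  refine le_trans ?_ (average_le_ballMax _ hxB')
  rw [setLIntegral_ball_indicator hΩ]
  refine mul_le_mul_right (lintegral_mono_ae ?_) _
  filter_upwards [hFle] with y hy
  gcongr

/-- On the unit ball of the modular, the maximal operator is bounded after division by a
constant. -/
lemma exists_modular_maximal_le (hn : 1 ≤ n) (hΩ : MeasurableSet Ω) (hφ : IsWeakPhi Ω φ)
    (hA0 : A0 Ω φ) (hA1 : A1 Ω φ) (hA2 : A2 Ω φ) {p : ℝ} (hp : 1 < p) {a t₀ : ℝ≥0} (ha : 1 ≤ a)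
    (hinf : ∀ᵐ x ∂(volume.restrict Ω), ∀ t l : ℝ≥0, t₀ ≤ t → 1 ≤ l →
      (l : ℝ≥0∞) ^ p * φ x t ≤ a * φ x (l * t))
    {G : Set (EuclideanSpace ℝ (Fin n))} (hGm : MeasurableSet G) (hGfin : volume G < ∞)
    (hG : ∀ᵐ x ∂(volume.restrict Ω), x ∉ G → ∀ t l : ℝ≥0, 0 < t → 1 ≤ l →
      (l : ℝ≥0∞) ^ p * φ x t ≤ a * φ x (l * t)) :
    ∃ D : ℝ≥0, 0 < D ∧ ∀ f : EuclideanSpace ℝ (Fin n) → ℝ, AEMeasurable f (volume.restrict Ω) →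
      modular Ω φ f ≤ 1 → (∀ᵐ x ∂(volume.restrict Ω), maximal Ω f x < ∞) ∧
        modular Ω φ (fun x => (maximal Ω f x).toReal / D) ≤ 1 := by
  have hne : Nonempty (Fin n) := ⟨⟨0, hn⟩⟩
  have hp0 : 0 < p := zero_lt_one.trans hp
  obtain ⟨h, ε, C, hhm, hhI, hhtop, hε, hC, hmain⟩ :=
    exists_apply_le_ballMax hn hΩ hφ hA0 hA1 hA2 hp ha hinf hG
  obtain ⟨L, hL, hscale⟩ := hφ.exists_le_mul
  have hL0 : 0 < L := zero_lt_one.trans_le hL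
  set N : ℝ≥0∞ := 2 * 5 ^ Module.finrank ℝ (EuclideanSpace ℝ (Fin n)) *
    ENNReal.ofReal (p / (p - 1)) * 2 ^ (p - 1) with hN
  have hNtop : N ≠ ∞ := by finiteness
  set H : ℝ≥0∞ := ∫⁻ x in Ω, h x with hH
  have hHtop : H ≠ ∞ := hhI.ne
  -- The summand `1` only serves to make `R` positive.
  set R : ℝ≥0∞ := C * (N * (1 + H) + H) + volume G + 1 with hR
  have hRtop : R ≠ ∞ := by have := hGfin.ne; finiteness
  set l : ℝ≥0 := min 1 (L * R.toNNReal)⁻¹ with hl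
  have hR0 : R ≠ 0 := by simp [hR]
  have hRpos : 0 < R.toNNReal := ENNReal.toNNReal_pos hR0 hRtop
  have hl0 : 0 < l := lt_min one_pos (by positivity)
  refine ⟨(l * (ε / 2))⁻¹, by positivity, fun f hf hmod => ?_⟩
  have hΦm : AEMeasurable (fun y => φ y ‖f y‖₊) (volume.restrict Ω) := hφ.measurable_comp f hf
  set g : EuclideanSpace ℝ (Fin n) → ℝ≥0∞ := Ω.indicator fun y => (φ y ‖f y‖₊ + h y) ^ p⁻¹ with hg
  have hgm : AEMeasurable g volume :=
    (aemeasurable_indicator_iff hΩ).2 ((hΦm.add hhm).pow_const _)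
  have hgI : ∫⁻ x, ballMax volume g x ^ p ≤ N * (1 + H) := by
    refine (lintegral_ballMax_rpow_le hp hgm).trans (mul_le_mul_right ?_ _)
    have h1 : (fun x => g x ^ p) = Ω.indicator fun y => φ y ‖f y‖₊ + h y := by
      funext x
      by_cases hx : x ∈ Ω
      · simp only [hg, indicator_of_mem hx, ENNReal.rpow_inv_rpow hp0.ne']
      · simp only [hg, indicator_of_notMem hx, ENNReal.zero_rpow_of_pos hp0]
    rw [h1, lintegral_indicator hΩ, lintegral_add_left' hΦm]
    gcongr
    exact hmod
  set T : EuclideanSpace ℝ (Fin n) → ℝ≥0∞ := fun x =>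
    C * (ballMax volume g x ^ p + h x) + G.indicator (fun _ => 1) x with hT
  have hTI : ∫⁻ x in Ω, T x ≤ R := by
    have hm : Measurable fun x => ballMax volume g x ^ p := (measurable_ballMax g).pow_const _
    rw [hT, lintegral_add_right _ (measurable_const.indicator hGm), lintegral_const_mul' _ _ hC,
      lintegral_add_left hm]
    refine le_add_right (add_le_add (mul_le_mul_right (add_le_add ?_ le_rfl) _) ?_)
    · exact (setLIntegral_le_lintegral _ _).trans hgI
    · refine (setLIntegral_le_lintegral _ _).trans_eq ?_
      rw [lintegral_indicator_const hGm, one_mul]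
  have hbtop : ∀ᵐ x ∂(volume.restrict Ω), ballMax volume g x ^ p < ∞ := by
    refine ae_restrict_of_ae (ae_lt_top ((measurable_ballMax g).pow_const _) ?_)
    exact (hgI.trans_lt (by finiteness)).ne
  have hfin : ∀ᵐ x ∂(volume.restrict Ω), maximal Ω f x < ∞ := by
    filter_upwards [hmain f hf hmod, hbtop, ae_restrict_mem hΩ] with x hx hxb hxΩ
    by_contra hcon
    have hxtop : maximal Ω f x = ∞ := not_lt_top_iff.1 hcon
    have hTx : T x < ∞ := by
      have h1 := hhtop x
      have h2 : G.indicator (fun _ => (1 : ℝ≥0∞)) x ≠ ∞ :=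
        ((indicator_le_self' (fun _ _ => zero_le) x).trans_lt ENNReal.one_lt_top).ne
      simp only [hT]
      finiteness
    have hev := (hφ.tendsto_top x hxΩ).eventually (lt_mem_nhds hTx)
    obtain ⟨t, ht⟩ := hev.exists
    have h3 := hx (t / ε) (by rw [hxtop]; exact ENNReal.coe_lt_top)
    rw [mul_div_cancel₀ _ hε.ne'] at h3
    exact h3.not_gt ht
  refine ⟨hfin, ?_⟩
  have hpt : ∀ᵐ x ∂(volume.restrict Ω),
      φ x ‖(maximal Ω f x).toReal / ((l * (ε / 2))⁻¹ : ℝ≥0)‖₊ ≤ L * l * T x := by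
    filter_upwards [hmain f hf hmod, hfin, ae_restrict_mem hΩ] with x hx hxtop hxΩ
    have h1 : ‖(maximal Ω f x).toReal / ((l * (ε / 2))⁻¹ : ℝ≥0)‖₊ =
        l * (ε * ((maximal Ω f x).toNNReal / 2)) := by
      rw [← NNReal.coe_inj, coe_nnnorm, Real.norm_of_nonneg (by positivity)]
      push_cast
      rw [div_inv_eq_mul]
      ring
    rw [h1]
    refine (hscale x hxΩ _ _ (min_le_left _ _)).trans (mul_le_mul_right ?_ _)
    rcases eq_or_ne (maximal Ω f x).toNNReal 0 with h0 | h0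
    · rw [h0]; simp [hφ.map_zero x hxΩ]
    · refine hx _ ?_
      conv_rhs => rw [← ENNReal.coe_toNNReal hxtop.ne]
      exact_mod_cast NNReal.half_lt_self h0
  calc modular Ω φ (fun x => (maximal Ω f x).toReal / ((l * (ε / 2))⁻¹ : ℝ≥0))
      ≤ ∫⁻ x in Ω, L * l * T x := lintegral_mono_ae hpt
    _ = L * l * ∫⁻ x in Ω, T x := lintegral_const_mul' _ _ (by finiteness)
    _ ≤ L * l * R := by gcongr
    _ = ((L * R.toNNReal * l : ℝ≥0) : ℝ≥0∞) := by
        push_cast; rw [ENNReal.coe_toNNReal hRtop]; ring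
    _ ≤ ((1 : ℝ≥0) : ℝ≥0∞) := by
        rw [ENNReal.coe_le_coe]
        calc L * R.toNNReal * l ≤ L * R.toNNReal * (L * R.toNNReal)⁻¹ := by
              gcongr; exact min_le_right _ _
          _ ≤ 1 := mul_inv_le_one
    _ = 1 := ENNReal.coe_one

lemma MemOrlicz.exists_modular_div_le_one (hφ : IsWeakPhi Ω φ) (hΩ : MeasurableSet Ω)
    {f : EuclideanSpace ℝ (Fin n) → ℝ} (hf : MemOrlicz Ω φ f) :
    ∃ c : ℝ≥0, 0 < c ∧ modular Ω φ (fun x => f x / c) ≤ 1 := by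
  obtain ⟨-, c, hc, hfin⟩ := hf
  obtain ⟨L, hL, hscale⟩ := hφ.exists_le_mul
  set I := modular Ω φ (fun x => c * f x) with hI
  have hL0 : 0 < L := zero_lt_one.trans_le hL
  set l : ℝ≥0 := min 1 (L * (I.toNNReal + 1))⁻¹
  have hl0 : 0 < l := lt_min one_pos (by positivity)
  refine ⟨(l * c)⁻¹, by positivity, ?_⟩
  calc modular Ω φ (fun x => f x / ((l * c)⁻¹ : ℝ≥0))
      ≤ ∫⁻ x in Ω, L * l * φ x ‖c * f x‖₊ := by
        refine setLIntegral_mono' hΩ fun x hx => ?_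
        have h1 : ‖f x / ((l * c)⁻¹ : ℝ≥0)‖₊ = l * ‖c * f x‖₊ := by
          rw [nnnorm_div, nnnorm_mul, NNReal.nnnorm_eq, NNReal.nnnorm_eq, div_inv_eq_mul]
          ring
        rw [h1]
        exact hscale x hx _ _ (min_le_left _ _)
    _ = L * l * I := lintegral_const_mul' _ _ (by finiteness)
    _ = ((L * I.toNNReal * l : ℝ≥0) : ℝ≥0∞) := by
        push_cast; rw [ENNReal.coe_toNNReal hfin.ne]; ring
    _ ≤ ((1 : ℝ≥0) : ℝ≥0∞) := by
        rw [ENNReal.coe_le_coe]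
        calc L * I.toNNReal * l ≤ L * (I.toNNReal + 1) * (L * (I.toNNReal + 1))⁻¹ := by
              gcongr
              · exact le_self_add
              · exact min_le_right _ _
          _ ≤ 1 := mul_inv_le_one
    _ = 1 := ENNReal.coe_one

lemma maximal_div (f : EuclideanSpace ℝ (Fin n) → ℝ) {c : ℝ≥0} (hc : 0 < c)
    (x : EuclideanSpace ℝ (Fin n)) :
    maximal Ω (fun y => f y / c) x = (c : ℝ≥0∞)⁻¹ * maximal Ω f x := by
  have hc' : (c : ℝ≥0∞)⁻¹ ≠ ∞ := ENNReal.inv_ne_top.2 (by exact_mod_cast hc.ne')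
  simp only [maximal, ENNReal.mul_iSup]
  refine iSup_congr fun z => iSup_congr fun r => iSup_congr fun _ => ?_
  rw [mul_left_comm, ← lintegral_const_mul' (c : ℝ≥0∞)⁻¹ _ hc']
  congr 1
  refine lintegral_congr fun y => ?_
  rw [nnnorm_div, NNReal.nnnorm_eq, ENNReal.coe_div hc.ne', div_eq_mul_inv, mul_comm]

/-- By homogeneity, boundedness follows from an estimate on the unit ball of the modular. -/
lemma maximalBounded_of_modular (hφ : IsWeakPhi Ω φ) (hΩ : MeasurableSet Ω) {D : ℝ≥0} (hD : 0 < D)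
    (h : ∀ f : EuclideanSpace ℝ (Fin n) → ℝ, AEMeasurable f (volume.restrict Ω) →
      modular Ω φ f ≤ 1 → (∀ᵐ x ∂(volume.restrict Ω), maximal Ω f x < ∞) ∧
        modular Ω φ (fun x => (maximal Ω f x).toReal / D) ≤ 1) :
    MaximalBounded Ω φ := by
  refine ⟨D, fun f hf => ?_⟩
  have key : ∀ c : ℝ≥0, 0 < c → modular Ω φ (fun x => f x / c) ≤ 1 →
      (∀ᵐ x ∂(volume.restrict Ω), maximal Ω f x < ∞) ∧
        modular Ω φ (fun x => (maximal Ω f x).toReal / (D * c : ℝ≥0)) ≤ 1 := by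
    intro c hc hmod
    have hc' : (c : ℝ≥0∞) ≠ 0 := by exact_mod_cast hc.ne'
    obtain ⟨h1, h2⟩ := h _ (hf.1.div_const _) hmod
    simp only [maximal_div f hc] at h1 h2
    constructor
    · filter_upwards [h1] with x hx
      by_contra hcon
      rw [not_lt_top_iff.1 hcon, ENNReal.mul_top (ENNReal.inv_ne_zero.2 ENNReal.coe_ne_top)] at hx
      exact hx.false
    · convert h2 using 2
      funext x
      rw [ENNReal.toReal_mul, ENNReal.toReal_inv, ENNReal.coe_toReal]
      push_cast
      rw [mul_comm (D : ℝ), ← div_div]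
      congr 1
      rw [div_eq_inv_mul]
  obtain ⟨c, hc, hmod⟩ := hf.exists_modular_div_le_one hφ hΩ
  refine ⟨(key c hc hmod).1, ⟨?_, (D * c)⁻¹, by positivity, ?_⟩, ?_⟩
  · rw [maximal_eq_ballMax hΩ]
    exact (measurable_ballMax _).ennreal_toReal.aemeasurable
  · refine lt_of_le_of_lt ?_ ENNReal.one_lt_top
    refine le_of_eq_of_le ?_ (key c hc hmod).2
    congr 1
    funext x
    rw [NNReal.coe_inv, div_eq_inv_mul]
  · simp only [orliczNorm]
    rw [ENNReal.mul_iInf_of_ne (by exact_mod_cast hD.ne') ENNReal.coe_ne_top]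
    refine le_iInf fun c => ?_
    rw [ENNReal.mul_iInf_of_ne (by exact_mod_cast hD.ne') ENNReal.coe_ne_top]
    refine le_iInf fun hc => ?_
    exact iInf₂_le_of_le (D * c) ⟨mul_pos hD hc.1, (key c hc.1 hc.2).2⟩ (by push_cast; rfl)

end GenOrlicz

theorem mainTheorem3 {n : ℕ} (hn : 1 ≤ n) {Ω : Set (EuclideanSpace ℝ (Fin n))} (hΩ : IsOpen Ω)
    (φ : EuclideanSpace ℝ (Fin n) → ℝ≥0 → ℝ≥0∞) (hφ : GenOrlicz.IsWeakPhi Ω φ)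
    (hA0 : GenOrlicz.A0 Ω φ) (hA1 : GenOrlicz.A1 Ω φ) (hA2 : GenOrlicz.A2 Ω φ)
    (hinf : GenOrlicz.AIncInfty Ω φ)
    (hG : ∃ G : Set (EuclideanSpace ℝ (Fin n)), G ⊆ Ω ∧ volume G < ∞ ∧
      ∃ p : ℝ, 1 < p ∧ GenOrlicz.AIncOn φ p (Ω \ G) (Ioi 0)) :
    GenOrlicz.MaximalBounded Ω φ := by
  obtain ⟨t₀, ht₀, q, hq, hincq⟩ := hinf
  obtain ⟨G, -, hGfin, p, hp, hincp⟩ := hG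
  obtain ⟨a₁, ha₁, h₁⟩ := hincq.rpow_mul_le (min_le_right p q)
  obtain ⟨a₂, ha₂, h₂⟩ := hincp.rpow_mul_le (min_le_left p q)
  have hΩm := hΩ.measurableSet
  have hlarge : ∀ᵐ x ∂(volume.restrict Ω), ∀ t l : ℝ≥0, t₀ ≤ t → 1 ≤ l →
      (l : ℝ≥0∞) ^ min p q * φ x t ≤ (max a₁ a₂ : ℝ≥0) * φ x (l * t) := by
    filter_upwards [ae_restrict_of_ae h₁, ae_restrict_mem hΩm] with x hx hxΩ t l ht hl
    refine (hx hxΩ t l (ht₀.trans_le ht) hl ht (ht.trans (le_mul_of_one_le_left zero_le hl))).trans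
      (mul_le_mul_left ?_ _)
    exact_mod_cast le_max_left _ _
  have hall : ∀ᵐ x ∂(volume.restrict Ω), x ∉ toMeasurable volume G → ∀ t l : ℝ≥0, 0 < t → 1 ≤ l →
      (l : ℝ≥0∞) ^ min p q * φ x t ≤ (max a₁ a₂ : ℝ≥0) * φ x (l * t) := by
    filter_upwards [ae_restrict_of_ae h₂, ae_restrict_mem hΩm] with x hx hxΩ hxG t l ht hl
    refine (hx ⟨hxΩ, fun hxG' => hxG (subset_toMeasurable _ _ hxG')⟩ t l ht hl ht
      (mul_pos (zero_lt_one.trans_le hl) ht)).trans (mul_le_mul_left ?_ _)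
    exact_mod_cast le_max_right _ _
  obtain ⟨D, hD, h⟩ := GenOrlicz.exists_modular_maximal_le hn hΩm hφ hA0 hA1 hA2 (lt_min hp hq)
    (ha₁.trans (le_max_left _ _)) hlarge (measurableSet_toMeasurable _ _)
    (by rwa [measure_toMeasurable]) hall
  exact GenOrlicz.maximalBounded_of_modular hφ hΩm hD h
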